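/- Let $(R,\mathfrak m)$ be a Noetherian local ring of prime characteristic $p>0$ and let $x\in\mathfrak m$ be a non-zero-divisor. For an ideal $I$ of a ring $A$, an $A$-module $M$ and $i\ge 0$, write $H^i_I(M)=\varinjlim_t \operatorname{Ext}^i_A(A/I^t,M)$ for local cohomology. For a ring $A$ of characteristic $p$, let $F_*A$ denote $A$ regarded as an $A$-module through the Frobenius $a\mapsto a^p$. A Noetherian local ring $(A,\mathfrak n)$ of characteristic $p$ is called $F$-injective if for every $i\ge 0$ the Frobenius action on $H^i_{\mathfrak n}(A)$, that is, the map $H^i_{\mathfrak n}(A)\to H^i_{\mathfrak n}(F_*A)\cong F_*H^i_{\mathfrak n}(A)$ induced by the $A$-linear Frobenius map $A\to F_*A$, is injective. Suppose that the local ring $R/xR$ is $F$-injective and that $x$ is a surjective element, i.e. for all $\ell>0$ and all $i\ge 0$ the map $H^i_{\mathfrak m}(R/x^\ell R)\to H^i_{\mathfrak m}(R/xR)$ induced by the natural surjection $R/x^\ell R\to R/xR$ is surjective. Then $R$ is $F$-injective. -/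

import Mathlib

open CategoryTheory IsLocalRing

universe u

namespace FInj

/-- The Frobenius pushforward `F_* M` of a module `M` over a ring `R` of prime characteristic `p`:
the abelian group `M` on which `r` acts as multiplication by `r ^ p`. -/
noncomputable abbrev frobeniusPushforward {R : Type u} [CommRing R] (p : ℕ) [Fact p.Prime]
    [CharP R p] (M : ModuleCat.{u} R) : ModuleCat.{u} R :=
  (ModuleCat.restrictScalars (frobenius R p)).obj M

/-- The Frobenius map `r ↦ r ^ p`, as an `R`-linear map `R → F_* R`. -/
noncomputable def frobeniusHom (R : Type u) [CommRing R] (p : ℕ) [Fact p.Prime] [CharP R p] :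
    ModuleCat.of R R ⟶ frobeniusPushforward p (ModuleCat.of R R) :=
  ModuleCat.ofHom (Y := frobeniusPushforward p (ModuleCat.of R R))
    { toFun := fun r => (frobenius R p r : R)
      map_add' := fun a b => map_add (frobenius R p) a b
      map_smul' := fun a b => map_mul (frobenius R p) a b }

/-- A local ring `(R, m)` of prime characteristic `p` is `F`-injective if for every `i ≥ 0` the
map `H^i_m(R) → H^i_m(F_* R) ≅ F_* H^i_m(R)` induced by the Frobenius `R → F_* R` is injective. -/
def IsFInjective (R : Type u) [CommRing R] [IsLocalRing R] (p : ℕ) [Fact p.Prime] [CharP R p] :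
    Prop :=
  ∀ i : ℕ, Function.Injective ((localCohomology (maximalIdeal R) i).map (frobeniusHom R p))

/-- The natural surjection `R / x ^ ℓ R → R / x R` for `ℓ > 0`, as a map of `R`-modules. -/
noncomputable def quotientPowHom {R : Type u} [CommRing R] (x : R) {ℓ : ℕ} (hℓ : 0 < ℓ) :
    ModuleCat.of R (R ⧸ Ideal.span {x ^ ℓ}) ⟶ ModuleCat.of R (R ⧸ Ideal.span {x}) :=
  ModuleCat.ofHom (Submodule.factor
    ((Ideal.span_singleton_le_span_singleton).2 (dvd_pow_self x hℓ.ne')))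

section quotient

variable {R : Type u} [CommRing R] [IsLocalRing R] {x : R}

theorem nontrivial_quotient (hx : x ∈ maximalIdeal R) : Nontrivial (R ⧸ Ideal.span {x}) :=
  Ideal.Quotient.nontrivial_iff.2 fun h =>
    (mem_maximalIdeal x).1 hx (Ideal.span_singleton_eq_top.1 h)

theorem isLocalRing_quotient (hx : x ∈ maximalIdeal R) : IsLocalRing (R ⧸ Ideal.span {x}) :=
  haveI := nontrivial_quotient hx
  .of_surjective' (Ideal.Quotient.mk _) Ideal.Quotient.mk_surjective

theorem charP_quotient (p : ℕ) [Fact p.Prime] [CharP R p] (hx : x ∈ maximalIdeal R) :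
    CharP (R ⧸ Ideal.span {x}) p :=
  haveI := nontrivial_quotient hx
  (CharP.charP_iff_prime_eq_zero Fact.out).2 <| by
    rw [← map_natCast (Ideal.Quotient.mk (Ideal.span {x})) p, CharP.cast_eq_zero, map_zero]

end quotient

end FInj

-- Write `H^i` for local cohomology at `m` and `F` for Frobenius. Frobenius maps the sequence `0 → R
-- → R → R/x → 0` (multiplication by `x`) to its own pushforward: it is `F` on the middle term and
-- on `R/x`, and `x^(p-1) F` on the left term. Suppose `η ∈ H^(i+1)(R)` satisfies `x η = 0` and `F η
-- = 0`. Then `η = δ ξ` with `ξ ∈ H^i(R/x)`, and naturality gives `δ (F ξ) = x^(p-1) F η = 0`. If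
-- the pushed-forward `δ` is injective, then `F ξ = 0`, so `ξ = 0` because `R/x` is `F`-injective.
-- In degree `0` already `x` is injective on `H^0(R)`. Every class is killed by a power of `x`, and
-- `F (x η) = x^p F η`, so an induction on that power reduces any element of `ker F` to this case.
-- Injectivity of `δ` is where surjectivity of `x` enters. It makes `x^t : H^i(R/x) →
-- H^i(R/x^(t+1))` injective (`injective_map_socleHom`). If `ξ` is the image of `η'` with `x^t η' =
-- 0`, then `ξ` dies under this map, hence vanishes (`injective_δ_mulSeq`). The remaining work is
-- independence of the base (`nonempty_iso`), used twice: to pass between `R` and `R/x`, and to pass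
-- between a module and its Frobenius pushforward. Both sides are `δ`-functors on `B`-modules with
-- the same degree `0` part, so it suffices that both are effaceable. Thus injective `B`-modules
-- must be acyclic over `A`, which is proved by splitting off torsion one generator of the ideal at
-- a time (`isZero_restrictScalars_of_injective`).

universe v₁ v₂ u₁ u₂

/-! ### Effaceable `δ`-functors and their comparison. -/

/-- A cohomological `δ`-functor between abelian categories, starting in degree `0`. -/
structure CohomologicalFunctor (C : Type u₁) [Category.{v₁} C] [Abelian C]
    (D : Type u₂) [Category.{v₂} D] [Abelian D] where
  /-- the functor in each degree -/
  T : ℕ → C ⥤ D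
  /-- the connecting morphisms -/
  δ : ∀ {S : ShortComplex C}, S.ShortExact → ∀ n, (T n).obj S.X₃ ⟶ (T (n + 1)).obj S.X₁
  δ_naturality : ∀ {S S' : ShortComplex C} (hS : S.ShortExact) (hS' : S'.ShortExact)
    (φ : S ⟶ S') (n : ℕ), δ hS n ≫ (T (n + 1)).map φ.τ₁ = (T n).map φ.τ₃ ≫ δ hS' n
  map_comp_zero : ∀ {S : ShortComplex C}, S.ShortExact → ∀ n,
    (T n).map S.f ≫ (T n).map S.g = 0
  comp_δ : ∀ {S : ShortComplex C} (hS : S.ShortExact) (n : ℕ), (T n).map S.g ≫ δ hS n = 0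
  δ_comp : ∀ {S : ShortComplex C} (hS : S.ShortExact) (n : ℕ),
    δ hS n ≫ (T (n + 1)).map S.f = 0
  exact₂ : ∀ {S : ShortComplex C} (hS : S.ShortExact) (n : ℕ),
    (ShortComplex.mk _ _ (map_comp_zero hS n)).Exact
  exact₃ : ∀ {S : ShortComplex C} (hS : S.ShortExact) (n : ℕ),
    (ShortComplex.mk _ _ (comp_δ hS n)).Exact
  exact₁ : ∀ {S : ShortComplex C} (hS : S.ShortExact) (n : ℕ),
    (ShortComplex.mk _ _ (δ_comp hS n)).Exact
  mono_zero : ∀ {S : ShortComplex C}, S.ShortExact → Mono ((T 0).map S.f)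

namespace CohomologicalFunctor

open Limits

section Comparison

variable {C : Type u₁} [Category.{v₁} C] [Abelian C] {D : Type u₂} [Category.{v₂} D] [Abelian D]

/-- A cohomological functor is effaceable if it vanishes on injectives in positive degrees. -/
def Effaceable (T : CohomologicalFunctor C D) : Prop :=
  ∀ (n : ℕ) (E : C), Injective E → IsZero ((T.T (n + 1)).obj E)

variable [EnoughInjectives C]

/-- The short complex `M ⟶ E ⟶ E / M` with `E` an injective object containing `M`. -/
noncomputable abbrev injSeq (M : C) : ShortComplex C :=
  ShortComplex.mk (Injective.ι M) (cokernel.π (Injective.ι M)) (cokernel.condition _)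

theorem injSeq_shortExact (M : C) : (injSeq M).ShortExact where
  exact := ShortComplex.exact_of_g_is_cokernel _ (cokernelIsCokernel _)

theorem exists_injSeq_map {M N : C} (f : M ⟶ N) :
    ∃ φ : injSeq M ⟶ injSeq N, φ.τ₁ = f := by
  let g := Injective.factorThru (f ≫ Injective.ι N) (Injective.ι M)
  have hg : Injective.ι M ≫ g = f ≫ Injective.ι N := Injective.comp_factorThru _ _
  exact ⟨{ τ₁ := f, τ₂ := g, τ₃ := cokernel.map _ _ f g hg
           comm₁₂ := hg.symm, comm₂₃ := by simp }, rfl⟩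

variable {T S : CohomologicalFunctor C D}

theorem Effaceable.epi_δ (hT : T.Effaceable) (M : C) (n : ℕ) :
    Epi (T.δ (injSeq_shortExact M) n) :=
  (T.exact₁ (injSeq_shortExact M) n).epi_f ((hT n _ inferInstance).eq_of_tgt _ _)

/-- Dimension shifting: `T^(n+1)` vanishes on the injective middle term, so `T^(n+1)(M)` is the
cokernel of `T^n(E) → T^n(E/M)`, and a map out of it is a map out of `T^n(E/M)` killing the image of
`T^n(E)`. -/
theorem exists_map_succ (hT : T.Effaceable) (n : ℕ) (e : T.T n ⟶ S.T n) (M : C) :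
    ∃ g : (T.T (n + 1)).obj M ⟶ (S.T (n + 1)).obj M,
      T.δ (injSeq_shortExact M) n ≫ g = e.app _ ≫ S.δ (injSeq_shortExact M) n := by
  have := hT.epi_δ M n
  refine ⟨(T.exact₃ (injSeq_shortExact M) n).desc
    (e.app _ ≫ S.δ (injSeq_shortExact M) n) ?_, ?_⟩
  · dsimp only
    rw [e.naturality_assoc]
    exact (congrArg (e.app _ ≫ ·) (S.comp_δ (injSeq_shortExact M) n)).trans comp_zero
  · exact (T.exact₃ (injSeq_shortExact M) n).g_desc _ _

/-- The map in degree `n + 1` induced by a natural transformation in degree `n`. -/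
noncomputable def natTransSucc (hT : T.Effaceable) (n : ℕ) (e : T.T n ⟶ S.T n) :
    T.T (n + 1) ⟶ S.T (n + 1) where
  app M := (exists_map_succ hT n e M).choose
  naturality M N f := by
    -- The extension of `f` to the injective sequences is not canonical, but any one suffices:
    -- equality is tested after the epimorphism `T.δ`.
    obtain ⟨φ, rfl⟩ := exists_injSeq_map f
    have := hT.epi_δ M n
    rw [← cancel_epi (T.δ (injSeq_shortExact M) n)]
    have h := T.δ_naturality (injSeq_shortExact M) (injSeq_shortExact N) φ n
    have h' := S.δ_naturality (injSeq_shortExact M) (injSeq_shortExact N) φ n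
    rw [reassoc_of% h, (exists_map_succ hT n e N).choose_spec, e.naturality_assoc, ← h',
      reassoc_of% (exists_map_succ hT n e M).choose_spec]

theorem δ_natTransSucc (hT : T.Effaceable) (n : ℕ) (e : T.T n ⟶ S.T n) (M : C) :
    T.δ (injSeq_shortExact M) n ≫ (natTransSucc hT n e).app M =
      e.app _ ≫ S.δ (injSeq_shortExact M) n :=
  (exists_map_succ hT n e M).choose_spec

theorem natTransSucc_comp_eq_id (hT : T.Effaceable) (hS : S.Effaceable) (n : ℕ)
    (e : T.T n ≅ S.T n) :
    natTransSucc hT n e.hom ≫ natTransSucc hS n e.inv = 𝟙 _ := by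
  ext M
  have := hT.epi_δ M n
  rw [← cancel_epi (T.δ (injSeq_shortExact M) n), NatTrans.comp_app,
    reassoc_of% δ_natTransSucc hT n e.hom M, δ_natTransSucc, NatTrans.id_app]
  simp

/-- Two effaceable cohomological functors which agree in degree `0` agree in all degrees. -/
theorem Effaceable.nonempty_iso (hT : T.Effaceable) (hS : S.Effaceable)
    (e : T.T 0 ≅ S.T 0) (n : ℕ) : Nonempty (T.T n ≅ S.T n) := by
  induction n with
  | zero => exact ⟨e⟩
  | succ n ih =>
    obtain ⟨e⟩ := ih
    exact ⟨⟨natTransSucc hT n e.hom, natTransSucc hS n e.inv,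
      natTransSucc_comp_eq_id hT hS n e, natTransSucc_comp_eq_id hS hT n e.symm⟩⟩

end Comparison

section Composition

variable {C : Type u₁} [Category.{v₁} C] [Abelian C] {D : Type u₂} [Category.{v₂} D] [Abelian D]

universe v₃ u₃

variable {C' : Type u₃} [Category.{v₃} C'] [Abelian C']

/-- Precomposition of a cohomological functor with an exact functor. -/
def precomp (F : C' ⥤ C) [F.Additive] [PreservesFiniteLimits F] [PreservesFiniteColimits F]
    (T : CohomologicalFunctor C D) : CohomologicalFunctor C' D where
  T n := F ⋙ T.T n
  δ hS n := T.δ (hS.map_of_exact F) n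
  δ_naturality hS hS' φ n := T.δ_naturality (hS.map_of_exact F) (hS'.map_of_exact F)
    (F.mapShortComplex.map φ) n
  map_comp_zero hS n := T.map_comp_zero (hS.map_of_exact F) n
  comp_δ hS n := T.comp_δ (hS.map_of_exact F) n
  δ_comp hS n := T.δ_comp (hS.map_of_exact F) n
  exact₁ hS n := T.exact₁ (hS.map_of_exact F) n
  exact₂ hS n := T.exact₂ (hS.map_of_exact F) n
  exact₃ hS n := T.exact₃ (hS.map_of_exact F) n
  mono_zero hS := T.mono_zero (hS.map_of_exact F)

/-- Postcomposition of a cohomological functor with an exact functor. -/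
def postcomp (T : CohomologicalFunctor C D) (F : D ⥤ C') [F.Additive]
    [PreservesFiniteLimits F] [PreservesFiniteColimits F] : CohomologicalFunctor C C' where
  T n := T.T n ⋙ F
  δ hS n := F.map (T.δ hS n)
  δ_naturality hS hS' φ n := by
    simp only [Functor.comp_map, ← F.map_comp, T.δ_naturality hS hS' φ n]
  map_comp_zero hS n := by
    simp only [Functor.comp_map, ← F.map_comp, T.map_comp_zero hS n, F.map_zero]
  comp_δ hS n := by simp only [Functor.comp_map, ← F.map_comp, T.comp_δ hS n, F.map_zero]
  δ_comp hS n := by simp only [Functor.comp_map, ← F.map_comp, T.δ_comp hS n, F.map_zero]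
  exact₁ hS n := (T.exact₁ hS n).map F
  exact₂ hS n := (T.exact₂ hS n).map F
  exact₃ hS n := (T.exact₃ hS n).map F
  mono_zero hS := by
    have := T.mono_zero hS
    exact inferInstanceAs (Mono (F.map ((T.T 0).map _)))

end Composition

end CohomologicalFunctor

/-! ### The long exact sequence of `Ext` in the second variable. -/

namespace ExtSequence

open Limits Opposite

variable (A : Type*) [Ring A] {C : Type u₁} [Category.{v₁} C] [Abelian C] [Linear A C]

theorem linearCoyoneda_shortExact (P : C) [Projective P] {S : ShortComplex C}
    (hS : S.ShortExact) : (S.map ((linearCoyoneda A C).obj (op P))).ShortExact where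
  exact := by
    rw [ShortComplex.moduleCat_exact_iff]
    intro (x : P ⟶ S.X₂) (hx : x ≫ S.g = 0)
    have := hS.mono_f
    exact ⟨hS.exact.lift x hx, hS.exact.lift_f x hx⟩
  mono_f := by
    rw [ModuleCat.mono_iff_injective]
    intro (x : P ⟶ S.X₁) (y : P ⟶ S.X₁) (h : x ≫ S.f = y ≫ S.f)
    have := hS.mono_f
    exact (cancel_mono S.f).1 h
  epi_g := by
    rw [ModuleCat.epi_iff_surjective]
    intro (x : P ⟶ S.X₃)
    have := hS.epi_g
    exact ⟨Projective.factorThru x S.g, Projective.factorThru_comp x S.g⟩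

/-- The complex of modules of morphisms from a chain complex `P` to an object `Y`, as a chain
complex in the opposite category. -/
noncomputable abbrev homComplex (P : ChainComplex C ℕ) (Y : C) :
    ChainComplex (ModuleCat.{v₁} A)ᵒᵖ ℕ :=
  (((linearYoneda A C).obj Y).rightOp.mapHomologicalComplex _).obj P

/-- The functoriality of `homComplex` in the target. -/
noncomputable abbrev homComplexMap (P : ChainComplex C ℕ) {Y Z : C} (f : Y ⟶ Z) :
    homComplex A P Z ⟶ homComplex A P Y :=
  (NatTrans.mapHomologicalComplex (NatTrans.rightOp ((linearYoneda A C).map f)) _).app P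

/-- The functoriality of `homComplex` in the source. -/
noncomputable abbrev homComplexPrecomp {P Q : ChainComplex C ℕ} (φ : P ⟶ Q) (Y : C) :
    homComplex A P Y ⟶ homComplex A Q Y :=
  (((linearYoneda A C).obj Y).rightOp.mapHomologicalComplex _).map φ

theorem homComplexPrecomp_naturality {P Q : ChainComplex C ℕ} (φ : P ⟶ Q) {Y Z : C} (f : Y ⟶ Z) :
    homComplexPrecomp A φ Z ≫ homComplexMap A Q f =
      homComplexMap A P f ≫ homComplexPrecomp A φ Y :=
  (NatTrans.mapHomologicalComplex (NatTrans.rightOp ((linearYoneda A C).map f)) _).naturality φ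

theorem homComplexMap_comp (P : ChainComplex C ℕ) {Y Z W : C} (f : Y ⟶ Z) (g : Z ⟶ W) :
    homComplexMap A P g ≫ homComplexMap A P f = homComplexMap A P (f ≫ g) := by
  ext n
  simp
  rfl

theorem homComplexMap_zero (P : ChainComplex C ℕ) (Y Z : C) :
    homComplexMap A P (0 : Y ⟶ Z) = 0 := by
  ext n
  exact Quiver.Hom.unop_inj (ModuleCat.hom_ext (LinearMap.ext fun _ => comp_zero))

/-- The short complex of complexes obtained by applying `homComplex` to a short complex. -/
noncomputable abbrev homComplexSeq (P : ChainComplex C ℕ) (S : ShortComplex C) :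
    ShortComplex (ChainComplex (ModuleCat.{v₁} A)ᵒᵖ ℕ) :=
  ShortComplex.mk (homComplexMap A P S.g) (homComplexMap A P S.f)
    (by rw [homComplexMap_comp, S.zero, homComplexMap_zero])

/-- `Hom(P_n, -)` is exact as `P_n` is projective. Passing to the opposite category reverses the
sequence, so `S.g` comes first and the connecting map lowers the degree. -/
theorem homComplexSeq_shortExact (P : ChainComplex C ℕ) (hP : ∀ n, Projective (P.X n))
    {S : ShortComplex C} (hS : S.ShortExact) : (homComplexSeq A P S).ShortExact := by
  refine HomologicalComplex.shortExact_of_degreewise_shortExact _ fun n => ?_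
  have := hP n
  exact (linearCoyoneda_shortExact A (P.X n) hS).op

theorem down_rel (n : ℕ) : (ComplexShape.down ℕ).Rel (n + 1) n := rfl

theorem projectiveResolution_shortExact {X : C} (P : ProjectiveResolution X) {S : ShortComplex C}
    (hS : S.ShortExact) : (homComplexSeq A P.complex S).ShortExact :=
  homComplexSeq_shortExact A P.complex P.projective hS

variable [EnoughProjectives C]

/-- The identification of `Ext` with the homology of a `homComplex`. -/
noncomputable abbrev extIso {X : C} (P : ProjectiveResolution X) (Y : C) (n : ℕ) :
    op (((Ext A C n).obj (op X)).obj Y) ≅ (homComplex A P.complex Y).homology n :=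
  P.isoLeftDerivedObj ((linearYoneda A C).obj Y).rightOp n

theorem extIso_hom_naturality_right {X : C} (P : ProjectiveResolution X) {Y Z : C} (f : Y ⟶ Z)
    (n : ℕ) : (((Ext A C n).obj (op X)).map f).op ≫ (extIso A P Y n).hom =
      (extIso A P Z n).hom ≫ HomologicalComplex.homologyMap (homComplexMap A P.complex f) n := by
  rw [← Iso.eq_comp_inv, Category.assoc]
  exact P.leftDerived_app_eq (NatTrans.rightOp ((linearYoneda A C).map f)) n

theorem extIso_hom_naturality_left {X X' : C} (P : ProjectiveResolution X)
    (P' : ProjectiveResolution X') (f : X ⟶ X') (φ : P.complex ⟶ P'.complex)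
    (comm : φ.f 0 ≫ P'.π.f 0 = P.π.f 0 ≫ f) (Y : C) (n : ℕ) :
    (((Ext A C n).map f.op).app Y).op ≫ (extIso A P' Y n).hom =
      (extIso A P Y n).hom ≫ HomologicalComplex.homologyMap (homComplexPrecomp A φ Y) n :=
  ProjectiveResolution.isoLeftDerivedObj_hom_naturality f P P' φ comm _ n

theorem extIso_inv_naturality_right {X : C} (P : ProjectiveResolution X) {Y Z : C} (f : Y ⟶ Z)
    (n : ℕ) : (extIso A P Z n).inv ≫ (((Ext A C n).obj (op X)).map f).op =
      HomologicalComplex.homologyMap (homComplexMap A P.complex f) n ≫ (extIso A P Y n).inv := by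
  rw [Iso.inv_comp_eq, ← Category.assoc, Iso.eq_comp_inv, extIso_hom_naturality_right]

theorem extIso_inv_naturality_left {X X' : C} (P : ProjectiveResolution X)
    (P' : ProjectiveResolution X') (f : X ⟶ X') (φ : P.complex ⟶ P'.complex)
    (comm : φ.f 0 ≫ P'.π.f 0 = P.π.f 0 ≫ f) (Y : C) (n : ℕ) :
    (extIso A P Y n).inv ≫ (((Ext A C n).map f.op).app Y).op =
      HomologicalComplex.homologyMap (homComplexPrecomp A φ Y) n ≫ (extIso A P' Y n).inv := by
  rw [Iso.inv_comp_eq, ← Category.assoc, Iso.eq_comp_inv,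
    extIso_hom_naturality_left A P P' f φ comm]

/-- The connecting morphism of the long exact sequence of `Ext`, in the opposite category. -/
noncomputable def extδOp (X : C) {S : ShortComplex C} (hS : S.ShortExact) (n : ℕ) :
    op (((Ext A C (n + 1)).obj (op X)).obj S.X₁) ⟶ op (((Ext A C n).obj (op X)).obj S.X₃) :=
  (extIso A (projectiveResolution X) S.X₁ (n + 1)).hom ≫
    (projectiveResolution_shortExact A (projectiveResolution X) hS).δ (n + 1) n (down_rel n) ≫
      (extIso A (projectiveResolution X) S.X₃ n).inv

/-- The connecting morphism of the long exact sequence of `Ext`. -/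
noncomputable def extδ (X : C) {S : ShortComplex C} (hS : S.ShortExact) (n : ℕ) :
    ((Ext A C n).obj (op X)).obj S.X₃ ⟶ ((Ext A C (n + 1)).obj (op X)).obj S.X₁ :=
  (extδOp A X hS n).unop

theorem extδ_naturality_left {X X' : C} (f : X ⟶ X') {S : ShortComplex C} (hS : S.ShortExact)
    (n : ℕ) : ((Ext A C n).map f.op).app S.X₃ ≫ extδ A X hS n =
      extδ A X' hS n ≫ ((Ext A C (n + 1)).map f.op).app S.X₁ := by
  apply Quiver.Hom.op_inj
  let P := projectiveResolution X
  let P' := projectiveResolution X'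
  let φ : P.complex ⟶ P'.complex := ProjectiveResolution.lift f P P'
  have comm : φ.f 0 ≫ P'.π.f 0 = P.π.f 0 ≫ f :=
    ProjectiveResolution.lift_commutes_zero f P P'
  change extδOp A X hS n ≫ (((Ext A C n).map f.op).app S.X₃).op =
    (((Ext A C (n + 1)).map f.op).app S.X₁).op ≫ extδOp A X' hS n
  simp only [extδOp, Category.assoc]
  rw [extIso_inv_naturality_left A P P' f φ comm]
  have h := extIso_hom_naturality_left A P P' f φ comm S.X₁ (n + 1)
  rw [reassoc_of% h]
  let ψ : homComplexSeq A P.complex S ⟶ homComplexSeq A P'.complex S :=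
    { τ₁ := homComplexPrecomp A φ S.X₃
      τ₂ := homComplexPrecomp A φ S.X₂
      τ₃ := homComplexPrecomp A φ S.X₁
      comm₁₂ := homComplexPrecomp_naturality A φ S.g
      comm₂₃ := homComplexPrecomp_naturality A φ S.f }
  have h := HomologicalComplex.HomologySequence.δ_naturality ψ
    (projectiveResolution_shortExact A P hS) (projectiveResolution_shortExact A P' hS)
    (n + 1) n (down_rel n)
  rw [reassoc_of% h]

theorem extδ_naturality_right (X : C) {S S' : ShortComplex C} (hS : S.ShortExact)
    (hS' : S'.ShortExact) (φ : S ⟶ S') (n : ℕ) :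
    extδ A X hS n ≫ ((Ext A C (n + 1)).obj (op X)).map φ.τ₁ =
      ((Ext A C n).obj (op X)).map φ.τ₃ ≫ extδ A X hS' n := by
  apply Quiver.Hom.op_inj
  let P := projectiveResolution X
  change (((Ext A C (n + 1)).obj (op X)).map φ.τ₁).op ≫ extδOp A X hS n =
    extδOp A X hS' n ≫ (((Ext A C n).obj (op X)).map φ.τ₃).op
  simp only [extδOp, Category.assoc]
  rw [extIso_inv_naturality_right A P]
  have h := extIso_hom_naturality_right A P φ.τ₁ (n + 1)
  rw [reassoc_of% h]
  let ψ : homComplexSeq A P.complex S' ⟶ homComplexSeq A P.complex S :=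
    { τ₁ := homComplexMap A P.complex φ.τ₃
      τ₂ := homComplexMap A P.complex φ.τ₂
      τ₃ := homComplexMap A P.complex φ.τ₁
      comm₁₂ := by simp only [homComplexMap_comp, φ.comm₂₃]
      comm₂₃ := by simp only [homComplexMap_comp, φ.comm₁₂] }
  have h := HomologicalComplex.HomologySequence.δ_naturality ψ
    (projectiveResolution_shortExact A P hS') (projectiveResolution_shortExact A P hS)
    (n + 1) n (down_rel n)
  rw [reassoc_of% h]

theorem ext_map_comp_zero (X : C) (S : ShortComplex C) (n : ℕ) :
    ((Ext A C n).obj (op X)).map S.f ≫ ((Ext A C n).obj (op X)).map S.g = 0 := by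
  apply Quiver.Hom.op_inj
  let P := projectiveResolution X
  change (((Ext A C n).obj (op X)).map S.g).op ≫ (((Ext A C n).obj (op X)).map S.f).op = 0
  rw [← cancel_mono (extIso A P _ n).hom, Category.assoc, extIso_hom_naturality_right,
    ← Category.assoc, extIso_hom_naturality_right, Category.assoc,
    ← HomologicalComplex.homologyMap_comp, homComplexMap_comp, S.zero, homComplexMap_zero]
  simp

theorem ext_comp_δ (X : C) {S : ShortComplex C} (hS : S.ShortExact) (n : ℕ) :
    ((Ext A C n).obj (op X)).map S.g ≫ extδ A X hS n = 0 := by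
  apply Quiver.Hom.op_inj
  change extδOp A X hS n ≫ (((Ext A C n).obj (op X)).map S.g).op = 0
  simp only [extδOp, Category.assoc]
  rw [extIso_inv_naturality_right]
  have h := (projectiveResolution_shortExact A (projectiveResolution X) hS).δ_comp
    (n + 1) n (down_rel n)
  rw [reassoc_of% h]
  simp

theorem ext_δ_comp (X : C) {S : ShortComplex C} (hS : S.ShortExact) (n : ℕ) :
    extδ A X hS n ≫ ((Ext A C (n + 1)).obj (op X)).map S.f = 0 := by
  apply Quiver.Hom.op_inj
  change (((Ext A C (n + 1)).obj (op X)).map S.f).op ≫ extδOp A X hS n = 0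
  simp only [extδOp]
  rw [← Category.assoc, extIso_hom_naturality_right, Category.assoc]
  have h := (projectiveResolution_shortExact A (projectiveResolution X) hS).comp_δ
    (n + 1) n (down_rel n)
  rw [reassoc_of% h]
  simp

instance (Y : C) : PreservesLimits ((linearYoneda A C).obj Y) :=
  have : PreservesLimits ((linearYoneda A C).obj Y ⋙ forget (ModuleCat.{v₁} A)) :=
    inferInstanceAs (PreservesLimits (yoneda.obj Y))
  preservesLimits_of_reflects_of_preserves _ (forget _)

instance (Y : C) : PreservesFiniteColimits ((linearYoneda A C).obj Y).rightOp :=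
  preservesFiniteColimits_rightOp _

/-- `Ext⁰(X, Y)` is the module of morphisms from `X` to `Y`. -/
noncomputable def extZeroIso (X Y : C) :
    ((linearYoneda A C).obj Y).obj (op X) ≅ ((Ext A C 0).obj (op X)).obj Y :=
  ((((linearYoneda A C).obj Y).rightOp.leftDerivedZeroIsoSelf).app X).unop

/-- This is naturality in the functor rather than in the object; it yields naturality of `Ext⁰ =
Hom` in the second variable. On a resolution it reduces to opcycles, a quotient of `F(P_0)`, where
it is naturality of `α`. -/
theorem fromLeftDerivedZero_naturality {D : Type*} [Category* D] [Abelian D] {F G : C ⥤ D}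
    [F.Additive] [G.Additive] (α : F ⟶ G) (X : C) :
    (NatTrans.leftDerived α 0).app X ≫ G.fromLeftDerivedZero.app X =
      F.fromLeftDerivedZero.app X ≫ α.app X := by
  let P := projectiveResolution X
  rw [P.leftDerived_app_eq, P.fromLeftDerivedZero_eq, P.fromLeftDerivedZero_eq]
  simp only [Category.assoc, Iso.inv_hom_id_assoc]
  have h : HomologicalComplex.opcyclesMap ((NatTrans.mapHomologicalComplex α
      (ComplexShape.down ℕ)).app P.complex) 0 ≫ P.fromLeftDerivedZero' G =
      P.fromLeftDerivedZero' F ≫ α.app X := by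
    rw [← cancel_epi (HomologicalComplex.pOpcycles _ _)]
    simp only [HomologicalComplex.p_opcyclesMap_assoc,
      ProjectiveResolution.pOpcycles_comp_fromLeftDerivedZero',
      ProjectiveResolution.pOpcycles_comp_fromLeftDerivedZero'_assoc]
    exact (α.naturality _).symm
  refine congrArg ((P.isoLeftDerivedObj F 0).hom ≫ ·) ?_
  refine Eq.trans ?_ ((congrArg ((ChainComplex.isoHomologyι₀ _).hom ≫ ·) h).trans
    (Category.assoc _ _ _).symm)
  exact HomologicalComplex.homologyι_naturality_assoc
    ((NatTrans.mapHomologicalComplex α (ComplexShape.down ℕ)).app P.complex) 0 _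

theorem extZeroIso_naturality_right (X : C) {Y Z : C} (f : Y ⟶ Z) :
    ((linearYoneda A C).map f).app (op X) ≫ (extZeroIso A X Z).hom =
      (extZeroIso A X Y).hom ≫ ((Ext A C 0).obj (op X)).map f :=
  (congrArg Quiver.Hom.unop (fromLeftDerivedZero_naturality
    (NatTrans.rightOp ((linearYoneda A C).map f)) X)).symm

theorem extZeroIso_naturality_left {X X' : C} (f : X ⟶ X') (Y : C) :
    ((linearYoneda A C).obj Y).map f.op ≫ (extZeroIso A X Y).hom =
      (extZeroIso A X' Y).hom ≫ ((Ext A C 0).map f.op).app Y :=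
  (congrArg Quiver.Hom.unop
    (((linearYoneda A C).obj Y).rightOp.fromLeftDerivedZero.naturality f)).symm

/-- The long exact sequence of `Ext` in the second variable. -/
noncomputable def extFunctor (X : C) : CohomologicalFunctor C (ModuleCat.{v₁} A) where
  T n := (Ext A C n).obj (op X)
  δ hS n := extδ A X hS n
  δ_naturality hS hS' φ n := extδ_naturality_right A X hS hS' φ n
  map_comp_zero {S} hS n := ext_map_comp_zero A X S n
  comp_δ hS n := ext_comp_δ A X hS n
  δ_comp hS n := ext_δ_comp A X hS n
  exact₂ {S} hS n := by
    rw [← ShortComplex.exact_op_iff]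
    refine (ShortComplex.exact_iff_of_iso (ShortComplex.isoMk (extIso A (projectiveResolution X) _ n)
      (extIso A (projectiveResolution X) _ n) (extIso A (projectiveResolution X) _ n) ?_ ?_)).2
      ((projectiveResolution_shortExact A (projectiveResolution X) hS).homology_exact₂ n)
    · exact (extIso_hom_naturality_right A _ S.g n).symm
    · exact (extIso_hom_naturality_right A _ S.f n).symm
  exact₃ {S} hS n := by
    rw [← ShortComplex.exact_op_iff]
    refine (ShortComplex.exact_iff_of_iso (ShortComplex.isoMk
      (extIso A (projectiveResolution X) _ (n + 1))
      (extIso A (projectiveResolution X) _ n) (extIso A (projectiveResolution X) _ n) ?_ ?_)).2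
      ((projectiveResolution_shortExact A (projectiveResolution X) hS).homology_exact₁
        (n + 1) n (down_rel n))
    · change _ = extδOp A X hS n ≫ _
      simp only [extδOp, Category.assoc, Iso.inv_hom_id, Category.comp_id]
      rfl
    · exact (extIso_hom_naturality_right A _ S.g n).symm
  exact₁ {S} hS n := by
    rw [← ShortComplex.exact_op_iff]
    refine (ShortComplex.exact_iff_of_iso (ShortComplex.isoMk
      (extIso A (projectiveResolution X) _ (n + 1)) (extIso A (projectiveResolution X) _ (n + 1))
      (extIso A (projectiveResolution X) _ n) ?_ ?_)).2
      ((projectiveResolution_shortExact A (projectiveResolution X) hS).homology_exact₃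
        (n + 1) n (down_rel n))
    · exact (extIso_hom_naturality_right A _ S.f (n + 1)).symm
    · change _ = extδOp A X hS n ≫ _
      simp only [extδOp, Category.assoc, Iso.inv_hom_id, Category.comp_id]
      rfl
  mono_zero {S} hS := by
    have h := extZeroIso_naturality_right A X S.f
    have := hS.mono_f
    have : Mono (((linearYoneda A C).map S.f).app (op X)) := by
      rw [ModuleCat.mono_iff_injective]
      intro (x : X ⟶ S.X₁) (y : X ⟶ S.X₁) (h : x ≫ S.f = y ≫ S.f)
      exact (cancel_mono S.f).1 h
    have : Mono ((extZeroIso A X S.X₁).hom ≫ ((Ext A C 0).obj (op X)).map S.f) := by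
      rw [← h]
      exact mono_comp' this (IsIso.mono_of_iso (extZeroIso A X S.X₂).hom)
    rw [← Iso.inv_hom_id_assoc (extZeroIso A X S.X₁) (((Ext A C 0).obj (op X)).map S.f)]
    infer_instance

/-- `Ext` is computed here from a projective resolution of `X`; injectivity of `E` enters because
`Hom(-, E)` keeps that resolution exact. -/
theorem isZero_ext_succ_of_injective (X E : C) [Injective E] (n : ℕ) :
    IsZero (((Ext A C (n + 1)).obj (op X)).obj E) := by
  let P := projectiveResolution X
  refine IsZero.unop (X := op (((Ext A C (n + 1)).obj (op X)).obj E))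
    (IsZero.of_iso ?_ (extIso A P E (n + 1)))
  rw [← HomologicalComplex.exactAt_iff_isZero_homology,
    HomologicalComplex.exactAt_iff' _ (n + 2) (n + 1) n (by simp) (by simp)]
  refine ShortComplex.Exact.op (S := ShortComplex.mk (X₁ := ModuleCat.of A (P.complex.X n ⟶ E))
    (X₂ := ModuleCat.of A (P.complex.X (n + 1) ⟶ E))
    (X₃ := ModuleCat.of A (P.complex.X (n + 2) ⟶ E))
    (ModuleCat.ofHom (Linear.leftComp A E (P.complex.d (n + 1) n)))
    (ModuleCat.ofHom (Linear.leftComp A E (P.complex.d (n + 2) (n + 1)))) ?_) ?_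
  · ext (x : P.complex.X n ⟶ E)
    simp
  · rw [ShortComplex.moduleCat_exact_iff]
    intro (x : P.complex.X (n + 1) ⟶ E) (hx : P.complex.d (n + 2) (n + 1) ≫ x = 0)
    have hex := P.exact_succ n
    exact ⟨hex.descToInjective x hx, hex.comp_descToInjective x hx⟩

section

variable (A : Type*) [CommRing A] {C : Type u₁} [Category.{v₁} C] [Abelian C] [Linear A C]
  [EnoughProjectives C]

/-- Multiplication by `r` on the resolution of `X` lifts `r • 𝟙 X = 0`, and so does the zero map;
the two induce the same map on `Ext`. On the `Hom` complex, multiplying the source by `r` is the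
same as multiplying the target. -/
theorem ext_map_smul_eq_zero (X Y : C) (r : A) (hr : r • 𝟙 X = 0) (n : ℕ) :
    ((Ext A C n).obj (op X)).map (r • 𝟙 Y) = 0 := by
  apply Quiver.Hom.op_inj
  let P := projectiveResolution X
  change (((Ext A C n).obj (op X)).map (r • 𝟙 Y)).op = 0
  have h₁ := extIso_hom_naturality_right A P (r • 𝟙 Y) n
  have h₂ := extIso_hom_naturality_left A P P (r • 𝟙 X) (r • 𝟙 P.complex)
    (((Linear.smul_comp _ _ _ r _ _).trans (congrArg (r • ·) (Category.id_comp _))).trans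
      ((Linear.comp_smul _ _ _ _ r _).trans (congrArg (r • ·) (Category.comp_id _))).symm) Y n
  have h₃ := extIso_hom_naturality_left A P P (r • 𝟙 X) 0
    (zero_comp.trans ((congrArg (P.π.f 0 ≫ ·) hr).trans comp_zero).symm) Y n
  have h : homComplexPrecomp A (r • 𝟙 P.complex) Y = homComplexMap A P.complex (r • 𝟙 Y) := by
    ext n
    refine Quiver.Hom.unop_inj (ModuleCat.hom_ext (LinearMap.ext fun x => ?_))
    change (r • 𝟙 (P.complex.X n)) ≫ (show P.complex.X n ⟶ Y from x) =
      (show P.complex.X n ⟶ Y from x) ≫ (r • 𝟙 Y)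
    rw [Linear.smul_comp, Linear.comp_smul, Category.id_comp, Category.comp_id]
  rw [h] at h₂
  rw [← cancel_mono (extIso A P Y n).hom, h₁, ← h₂, h₃]
  simp [homComplexPrecomp]

end

end ExtSequence

/-! ### Local cohomology as an effaceable `δ`-functor. -/

namespace LocalCohomology

open Limits Opposite

variable {R : Type u} [CommRing R] (J : Ideal R)

/-- The module `R / J ^ t`. -/
noncomputable abbrev quotPow (t : ℕ) : ModuleCat.{u} R :=
  (localCohomology.ringModIdeals (localCohomology.idealPowersDiagram J)).obj (op t)

/-- The projection `R / J ^ t ⟶ R / J ^ s`. -/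
noncomputable abbrev quotPowMap {s t : ℕ} (h : s ≤ t) : quotPow J t ⟶ quotPow J s :=
  (localCohomology.ringModIdeals (localCohomology.idealPowersDiagram J)).map (homOfLE h).op

/-- The natural map from `Ext^n(R / J ^ t, -)` to local cohomology. -/
noncomputable def ι (n t : ℕ) :
    (Ext R (ModuleCat.{u} R) n).obj (op (quotPow J t)) ⟶ localCohomology J n :=
  colimit.ι (localCohomology.diagram (localCohomology.idealPowersDiagram J) n) (op (op t))

theorem map_quotPowMap_ι (n : ℕ) {s t : ℕ} (h : s ≤ t) :
    (Ext R (ModuleCat.{u} R) n).map (quotPowMap J h).op ≫ ι J n t = ι J n s :=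
  colimit.w (localCohomology.diagram (localCohomology.idealPowersDiagram J) n)
    (homOfLE h).op.op

/-- Local cohomology of a module as a colimit of modules. -/
noncomputable def isColimit (n : ℕ) (M : ModuleCat.{u} R) :
    IsColimit (((evaluation _ _).obj M).mapCocone (colimit.cocone
      (localCohomology.diagram (localCohomology.idealPowersDiagram J) n))) :=
  isColimitOfPreserves _ (colimit.isColimit _)

instance : PreservesColimitsOfShape (ℕᵒᵖ)ᵒᵖ (forget (ModuleCat.{u} R)) :=
  have := preservesFilteredColimitsOfSize_shrink.{0, u, 0, u} (forget (ModuleCat.{u} R))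
  PreservesFilteredColimitsOfSize.preserves_filtered_colimits _

theorem exists_ι_eq (n : ℕ) {M : ModuleCat.{u} R} (ξ : (localCohomology J n).obj M) :
    ∃ (t : ℕ) (y : ((Ext R (ModuleCat.{u} R) n).obj (op (quotPow J t))).obj M),
      ((ι J n t).app M) y = ξ := by
  obtain ⟨t, y, hy⟩ := Concrete.isColimit_exists_rep _ (isColimit J n M) ξ
  exact ⟨t.unop.unop, y, hy⟩

theorem exists_map_eq_zero (n : ℕ) {M : ModuleCat.{u} R} {t : ℕ}
    (y : ((Ext R (ModuleCat.{u} R) n).obj (op (quotPow J t))).obj M)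
    (hy : ((ι J n t).app M) y = 0) :
    ∃ (s : ℕ) (h : t ≤ s), ((Ext R (ModuleCat.{u} R) n).map (quotPowMap J h).op).app M y = 0 := by
  obtain ⟨k, f, g, h⟩ := Concrete.isColimit_exists_of_rep_eq _ (isColimit J n M)
    (i := op (op t)) (j := op (op t)) y 0 (hy.trans (map_zero ((ι J n t).app M).hom).symm)
  refine ⟨k.unop.unop, leOfHom f.unop.unop, ?_⟩
  exact h.trans (map_zero _)

theorem hom_ext {n : ℕ} {M N : ModuleCat.{u} R} {f g : (localCohomology J n).obj M ⟶ N}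
    (h : ∀ t, (ι J n t).app M ≫ f = (ι J n t).app M ≫ g) : f = g :=
  (isColimit J n M).hom_ext fun t => h t.unop.unop

theorem exists_desc {n : ℕ} {M N : ModuleCat.{u} R}
    (f : ∀ t, ((Ext R (ModuleCat.{u} R) n).obj (op (quotPow J t))).obj M ⟶ N)
    (hf : ∀ s t (h : s ≤ t),
      ((Ext R (ModuleCat.{u} R) n).map (quotPowMap J h).op).app M ≫ f t = f s) :
    ∃ g : (localCohomology J n).obj M ⟶ N, ∀ t, (ι J n t).app M ≫ g = f t :=
  ⟨(isColimit J n M).desc ⟨N,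
    { app t := f t.unop.unop
      naturality s t h := by
        simp only [Functor.const_obj_obj, Functor.const_obj_map]
        exact hf _ _ (leOfHom h.unop.unop) }⟩,
    fun t => (isColimit J n M).fac _ (op (op t))⟩

section

open ExtSequence

theorem exists_δ {S : ShortComplex (ModuleCat.{u} R)} (hS : S.ShortExact) (n : ℕ) :
    ∃ g : (localCohomology J n).obj S.X₃ ⟶ (localCohomology J (n + 1)).obj S.X₁,
      ∀ t, (ι J n t).app S.X₃ ≫ g = extδ R (quotPow J t) hS n ≫ (ι J (n + 1) t).app S.X₁ := by
  refine exists_desc J _ fun s t h => ?_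
  rw [← Category.assoc, extδ_naturality_left, Category.assoc, ← NatTrans.comp_app,
    map_quotPowMap_ι]

/-- The connecting morphism of local cohomology. -/
noncomputable def δ {S : ShortComplex (ModuleCat.{u} R)} (hS : S.ShortExact) (n : ℕ) :
    (localCohomology J n).obj S.X₃ ⟶ (localCohomology J (n + 1)).obj S.X₁ :=
  (exists_δ J hS n).choose

theorem ι_δ {S : ShortComplex (ModuleCat.{u} R)} (hS : S.ShortExact) (n t : ℕ) :
    (ι J n t).app S.X₃ ≫ δ J hS n = extδ R (quotPow J t) hS n ≫ (ι J (n + 1) t).app S.X₁ :=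
  (exists_δ J hS n).choose_spec t

/-- If, for each `t`, a sequence of modules is exact, then so is the colimit of these sequences. -/
theorem exact_of_ext {a b c : ℕ} {L M N : ModuleCat.{u} R}
    (f : (localCohomology J a).obj L ⟶ (localCohomology J b).obj M)
    (g : (localCohomology J b).obj M ⟶ (localCohomology J c).obj N) (w : f ≫ g = 0)
    (f' : ∀ t, ((Ext R (ModuleCat.{u} R) a).obj (op (quotPow J t))).obj L ⟶
      ((Ext R (ModuleCat.{u} R) b).obj (op (quotPow J t))).obj M)
    (g' : ∀ t, ((Ext R (ModuleCat.{u} R) b).obj (op (quotPow J t))).obj M ⟶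
      ((Ext R (ModuleCat.{u} R) c).obj (op (quotPow J t))).obj N)
    (hf : ∀ t, (ι J a t).app L ≫ f = f' t ≫ (ι J b t).app M)
    (hg : ∀ t, (ι J b t).app M ≫ g = g' t ≫ (ι J c t).app N)
    (hg' : ∀ s t (h : s ≤ t), ((Ext R (ModuleCat.{u} R) b).map (quotPowMap J h).op).app M ≫ g' t =
      g' s ≫ ((Ext R (ModuleCat.{u} R) c).map (quotPowMap J h).op).app N)
    (hex : ∀ t y, g' t y = 0 → ∃ x, f' t x = y) :
    (ShortComplex.mk f g w).Exact := by
  rw [ShortComplex.moduleCat_exact_iff]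
  intro (ξ : (localCohomology J b).obj M) (hξ : g ξ = 0)
  obtain ⟨t, y, rfl⟩ := exists_ι_eq J b ξ
  have h₁ : (ι J c t).app N (g' t y) = 0 :=
    (ConcreteCategory.congr_hom (hg t) y).symm.trans hξ
  -- The image of `y` need not vanish at stage `t`, only at some later stage `s`; exactness is
  -- applied there.
  obtain ⟨s, h, hs⟩ := exists_map_eq_zero J c _ h₁
  obtain ⟨x, hx⟩ := hex s (((Ext R (ModuleCat.{u} R) b).map (quotPowMap J h).op).app M y)
    ((ConcreteCategory.congr_hom (hg' t s h) y).trans hs)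
  refine ⟨(ι J a s).app L x, (ConcreteCategory.congr_hom (hf s) x).trans ?_⟩
  change (ι J b s).app M (f' s x) = _
  rw [hx]
  exact ConcreteCategory.congr_hom (NatTrans.congr_app (map_quotPowMap_ι J b h) M) y

/-- Local cohomology as a cohomological functor. -/
noncomputable def cohomologicalFunctor :
    CohomologicalFunctor (ModuleCat.{u} R) (ModuleCat.{u} R) where
  T n := localCohomology J n
  δ hS n := δ J hS n
  δ_naturality {S S'} hS hS' φ n := by
    refine hom_ext J fun t => ?_
    rw [← Category.assoc, ι_δ, Category.assoc, ← NatTrans.naturality, ← Category.assoc,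
      extδ_naturality_right R _ hS hS' φ n, Category.assoc, ← ι_δ, NatTrans.naturality_assoc]
  map_comp_zero {S} hS n := by
    refine hom_ext J fun t => ?_
    rw [← NatTrans.naturality_assoc, ← NatTrans.naturality, ← Category.assoc,
      ext_map_comp_zero R (quotPow J t) S n, zero_comp, comp_zero]
  comp_δ hS n := by
    refine hom_ext J fun t => ?_
    rw [← NatTrans.naturality_assoc, ι_δ, ← Category.assoc, ext_comp_δ, zero_comp, comp_zero]
  δ_comp hS n := by
    refine hom_ext J fun t => ?_
    rw [← Category.assoc, ι_δ, Category.assoc, ← NatTrans.naturality, ← Category.assoc,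
      ext_δ_comp, zero_comp, comp_zero]
  exact₂ hS n := exact_of_ext J _ _ _ _ _
    (fun t => ((ι J n t).naturality _).symm) (fun t => ((ι J n t).naturality _).symm)
    (fun s t h => (((Ext R (ModuleCat.{u} R) n).map (quotPowMap J h).op).naturality _).symm)
    (fun t => (ShortComplex.moduleCat_exact_iff _).1 ((extFunctor R (quotPow J t)).exact₂ hS n))
  exact₃ hS n := exact_of_ext J _ _ _ _ _
    (fun t => ((ι J n t).naturality _).symm) (fun t => ι_δ J hS n t)
    (fun s t h => extδ_naturality_left R _ hS n)
    (fun t => (ShortComplex.moduleCat_exact_iff _).1 ((extFunctor R (quotPow J t)).exact₃ hS n))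
  exact₁ hS n := exact_of_ext J _ _ _ _ _
    (fun t => ι_δ J hS n t) (fun t => ((ι J (n + 1) t).naturality _).symm)
    (fun s t h => (((Ext R (ModuleCat.{u} R) (n + 1)).map (quotPowMap J h).op).naturality _).symm)
    (fun t => (ShortComplex.moduleCat_exact_iff _).1 ((extFunctor R (quotPow J t)).exact₁ hS n))
  mono_zero {S} hS := by
    rw [ModuleCat.mono_iff_injective, injective_iff_map_eq_zero]
    intro ξ hξ
    obtain ⟨t, y, rfl⟩ := exists_ι_eq J 0 ξ
    have h₁ : (ι J 0 t).app S.X₂ (((Ext R (ModuleCat.{u} R) 0).obj (op (quotPow J t))).map S.f y)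
        = 0 := (ConcreteCategory.congr_hom ((ι J 0 t).naturality S.f) y).trans hξ
    obtain ⟨s, h, hs⟩ := exists_map_eq_zero J 0 _ h₁
    have h₂ := ConcreteCategory.congr_hom
      (((Ext R (ModuleCat.{u} R) 0).map (quotPowMap J h).op).naturality S.f) y
    have h₃ := (ModuleCat.mono_iff_injective _).1 ((extFunctor R (quotPow J s)).mono_zero hS)
    have h₄ : ((Ext R (ModuleCat.{u} R) 0).map (quotPowMap J h).op).app S.X₁ y = 0 :=
      h₃ ((h₂.symm.trans hs).trans (map_zero _).symm)
    have h₅ := ConcreteCategory.congr_hom (NatTrans.congr_app (map_quotPowMap_ι J 0 h) S.X₁) y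
    rw [← h₅]
    exact (congrArg ((ι J 0 s).app S.X₁) h₄).trans (map_zero ((ι J 0 s).app S.X₁).hom)

theorem effaceable : (cohomologicalFunctor J).Effaceable := fun n E _ => by
  rw [IsZero.iff_id_eq_zero]
  refine hom_ext J fun t => ?_
  exact (isZero_ext_succ_of_injective R (quotPow J t) E n).eq_of_src _ _

theorem smul_id_quotPow {r : R} {t : ℕ} (hr : r ∈ J ^ t) : r • 𝟙 (quotPow J t) = 0 := by
  ext (x : R ⧸ J ^ t)
  obtain ⟨x, rfl⟩ := Ideal.Quotient.mk_surjective x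
  exact Ideal.Quotient.eq_zero_iff_mem.2 (Ideal.mul_mem_right x _ hr)

/-- Every local cohomology class is annihilated by a power of the ideal. -/
theorem exists_pow_map_smul_eq_zero (n : ℕ) {M : ModuleCat.{u} R}
    (ξ : (localCohomology J n).obj M) : ∃ t, ∀ r ∈ J ^ t, (localCohomology J n).map (r • 𝟙 M) ξ = 0 := by
  obtain ⟨t, y, rfl⟩ := exists_ι_eq J n ξ
  refine ⟨t, fun r hr => ?_⟩
  have h := ConcreteCategory.congr_hom ((ι J n t).naturality (r • 𝟙 M)) y
  rw [ext_map_smul_eq_zero R _ _ _ (smul_id_quotPow J hr)] at h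
  exact h.symm.trans (map_zero ((ι J n t).app M).hom)

end

end LocalCohomology

/-! ### Degree zero: power torsion elements. -/

namespace LocalCohomology

open Limits Opposite ExtSequence

variable {R : Type u} [CommRing R] (J : Ideal R)

/-- The class of `1` in `R / J ^ t`. -/
def quotPowOne (t : ℕ) : quotPow J t := Ideal.Quotient.mk (J ^ t) 1

/-- Evaluation at `1` of a morphism from `R / J ^ t`. -/
noncomputable def evalOne (t : ℕ) (M : ModuleCat.{u} R) :
    ((linearYoneda R (ModuleCat.{u} R)).obj M).obj (op (quotPow J t)) ⟶ M :=
  ModuleCat.ofHom (X := quotPow J t ⟶ M)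
    { toFun := fun f => f (quotPowOne J t)
      map_add' := fun _ _ => rfl
      map_smul' := fun _ _ => rfl }

theorem evalOne_injective (t : ℕ) (M : ModuleCat.{u} R) :
    Function.Injective (evalOne J t M) := by
  intro (f : quotPow J t ⟶ M) (g : quotPow J t ⟶ M) (h : f (quotPowOne J t) = g (quotPowOne J t))
  refine ModuleCat.hom_ext (LinearMap.ext fun (x : R ⧸ J ^ t) => ?_)
  obtain ⟨x, rfl⟩ := Ideal.Quotient.mk_surjective x
  have hx : (Ideal.Quotient.mk (J ^ t) x : quotPow J t) = x • quotPowOne J t :=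
    (congrArg (Ideal.Quotient.mk (J ^ t)) (mul_one x)).symm
  exact (congrArg f hx).trans ((map_smul f.hom x _).trans ((congrArg (x • ·) h).trans
    ((map_smul g.hom x _).symm.trans (congrArg g hx).symm)))

theorem exists_evalOne_eq {t : ℕ} {M : ModuleCat.{u} R} (m : M) (hm : ∀ r ∈ J ^ t, r • m = 0) :
    ∃ f, evalOne J t M f = m :=
  ⟨ModuleCat.ofHom (Submodule.liftQ (J ^ t) (LinearMap.toSpanSingleton R M m) hm),
    one_smul R m⟩

theorem exists_toSelf (M : ModuleCat.{u} R) : ∃ g : (localCohomology J 0).obj M ⟶ M,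
    ∀ t, (ι J 0 t).app M ≫ g = (extZeroIso R (quotPow J t) M).inv ≫ evalOne J t M := by
  refine exists_desc J _ fun s t h => ?_
  rw [← cancel_epi (extZeroIso R (quotPow J s) M).hom, Iso.hom_inv_id_assoc]
  have := extZeroIso_naturality_left R (quotPowMap J h) M
  rw [← reassoc_of% this, Iso.hom_inv_id_assoc]
  rfl

/-- The natural map from the `0`-th local cohomology of `M` to `M`. -/
noncomputable def toSelf : localCohomology J 0 ⟶ 𝟭 (ModuleCat.{u} R) where
  app M := (exists_toSelf J M).choose
  naturality M N f := by
    refine hom_ext J fun t => ?_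
    rw [← NatTrans.naturality_assoc, (exists_toSelf J N).choose_spec,
      reassoc_of% (exists_toSelf J M).choose_spec,
      ← cancel_epi (extZeroIso R (quotPow J t) M).hom, Iso.hom_inv_id_assoc,
      ← reassoc_of% extZeroIso_naturality_right R (quotPow J t) f, Iso.hom_inv_id_assoc]
    rfl

theorem ι_toSelf (t : ℕ) (M : ModuleCat.{u} R) : (ι J 0 t).app M ≫ (toSelf J).app M =
    (extZeroIso R (quotPow J t) M).inv ≫ evalOne J t M :=
  (exists_toSelf J M).choose_spec t

theorem toSelf_injective (M : ModuleCat.{u} R) : Function.Injective ((toSelf J).app M) := by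
  rw [injective_iff_map_eq_zero]
  intro ξ hξ
  obtain ⟨t, y, rfl⟩ := exists_ι_eq J 0 ξ
  have h := (ConcreteCategory.congr_hom (ι_toSelf J t M) y).symm.trans hξ
  have h₁ : (extZeroIso R (quotPow J t) M).inv y = 0 :=
    evalOne_injective J t M (h.trans (map_zero (evalOne J t M).hom).symm)
  have h₂ : y = 0 := (ModuleCat.mono_iff_injective _).1
    (IsIso.mono_of_iso (extZeroIso R (quotPow J t) M).inv)
    (h₁.trans (map_zero (extZeroIso R (quotPow J t) M).inv.hom).symm)
  exact (congrArg ((ι J 0 t).app M) h₂).trans (map_zero ((ι J 0 t).app M).hom)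

/-- Together with `toSelf_injective` this identifies `H^0_J(M)` with the `J`-power torsion of `M`,
so degree `0` comparisons become comparisons of subsets of `M`. -/
theorem mem_range_toSelf (M : ModuleCat.{u} R) (m : M) :
    (∃ ξ, (toSelf J).app M ξ = m) ↔ ∃ t, ∀ r ∈ J ^ t, r • m = 0 := by
  constructor
  · rintro ⟨ξ, rfl⟩
    obtain ⟨t, ht⟩ := exists_pow_map_smul_eq_zero J 0 ξ
    refine ⟨t, fun r hr => ?_⟩
    have h := ConcreteCategory.congr_hom ((toSelf J).naturality (r • 𝟙 M)) ξ
    exact h.symm.trans ((congrArg ((toSelf J).app M) (ht r hr)).trans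
      (map_zero ((toSelf J).app M).hom))
  · rintro ⟨t, ht⟩
    obtain ⟨f, hf⟩ := exists_evalOne_eq J m ht
    refine ⟨(ι J 0 t).app M ((extZeroIso R (quotPow J t) M).hom f), ?_⟩
    have h := ConcreteCategory.congr_hom (ι_toSelf J t M) ((extZeroIso R (quotPow J t) M).hom f)
    refine h.trans (Eq.trans ?_ hf)
    exact congrArg (evalOne J t M) (ConcreteCategory.congr_hom
      (extZeroIso R (quotPow J t) M).hom_inv_id f)

end LocalCohomology

/-! ### Power torsion in injective modules over Noetherian rings. -/

section PowTorsion

variable {B : Type u} [CommRing B] (I : Ideal B) (E : Type u) [AddCommGroup E] [Module B E]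

/-- The submodule of elements annihilated by a power of the ideal `I`. -/
def powTorsion : Submodule B E where
  carrier := {e | ∃ t, ∀ r ∈ I ^ t, r • e = 0}
  zero_mem' := ⟨0, fun _ _ => smul_zero _⟩
  add_mem' := by
    rintro a b ⟨s, hs⟩ ⟨t, ht⟩
    refine ⟨s + t, fun r hr => ?_⟩
    rw [smul_add, hs r (Ideal.pow_le_pow_right (Nat.le_add_right s t) hr),
      ht r (Ideal.pow_le_pow_right (Nat.le_add_left t s) hr), add_zero]
  smul_mem' := by
    rintro c a ⟨s, hs⟩
    exact ⟨s, fun r hr => by rw [smul_comm, hs r hr, smul_zero]⟩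

variable {I E}

theorem mem_powTorsion {e : E} : e ∈ powTorsion I E ↔ ∃ t, ∀ r ∈ I ^ t, r • e = 0 := Iff.rfl

theorem mem_powTorsion_singleton {b : B} {e : E} :
    e ∈ powTorsion (Ideal.span {b}) E ↔ ∃ t, b ^ t • e = 0 := by
  refine exists_congr fun t => ⟨fun h => h _ (by
    rw [Ideal.span_singleton_pow]; exact Ideal.mem_span_singleton_self _), fun h r hr => ?_⟩
  rw [Ideal.span_singleton_pow, Ideal.mem_span_singleton'] at hr
  obtain ⟨c, rfl⟩ := hr
  rw [mul_smul, h, smul_zero]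

/-- A finitely generated submodule of `I`-power torsion elements is annihilated by a single power
of `I`. -/
theorem exists_pow_smul_eq_zero_of_fg {N : Submodule B E} (hN : N.FG) (h : N ≤ powTorsion I E) :
    ∃ t, ∀ r ∈ I ^ t, ∀ e ∈ N, r • e = 0 := by
  obtain ⟨s, rfl⟩ := hN
  choose! t ht using fun e (he : e ∈ s) => mem_powTorsion.1 (h (Submodule.subset_span he))
  refine ⟨s.sup t, fun r hr e he => ?_⟩
  induction he using Submodule.span_induction with
  | mem e he => exact ht e he r (Ideal.pow_le_pow_right (Finset.le_sup he) hr)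
  | zero => exact smul_zero _
  | add a b _ _ ha hb => rw [smul_add, ha, hb, add_zero]
  | smul c a _ ha => rw [smul_comm, ha, smul_zero]

/-- Baer's criterion with Artin–Rees. The image of `g : K → Γ_I(E)` is killed by some `I^s`, and
`I^(s+k) ∩ K ⊆ I^s K ⊆ ker g`. Hence `g` factors through `K / (I^(s+k) ∩ K)`, which embeds in `B /
I^(s+k)`. The extension of this map to `B / I^(s+k) → E` has values killed by `I^(s+k)`, so it lands
in the torsion. -/
theorem injective_powTorsion [IsNoetherianRing B] [Module.Injective B E] (I : Ideal B) :
    Module.Injective B (powTorsion I E) := by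
  refine Module.Baer.injective fun K g => ?_
  obtain ⟨s, hs⟩ : ∃ s, ∀ r ∈ I ^ s, ∀ x : K, r • g x = 0 := by
    obtain ⟨s, hs⟩ := exists_pow_smul_eq_zero_of_fg (I := I)
      (N := LinearMap.range ((powTorsion I E).subtype ∘ₗ g))
      (by
        rw [LinearMap.range_eq_map]
        exact Submodule.FG.map _ (IsNoetherian.noetherian _))
      (by rintro _ ⟨x, rfl⟩; exact (g x).2)
    exact ⟨s, fun r hr x => Subtype.ext (hs r hr _ ⟨x, rfl⟩)⟩
  obtain ⟨k, hk⟩ := Ideal.exists_pow_inf_eq_pow_smul (M := B) I K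
  have hker : ∀ x : K, (x : B) ∈ I ^ (s + k) → g x = 0 := by
    intro x hx
    have h₁ : (x : B) ∈ I ^ (s + k) • (⊤ : Submodule B B) ⊓ K := by
      refine ⟨?_, x.2⟩
      rw [smul_eq_mul, Ideal.mul_top]
      exact hx
    rw [hk (s + k) (Nat.le_add_left k s), Nat.add_sub_cancel] at h₁
    have h₂ : (x : B) ∈ I ^ s • K := Submodule.smul_mono le_rfl inf_le_right h₁
    have h₃ : I ^ s • K ≤ (LinearMap.ker g).map (Submodule.subtype K) := by
      rw [Submodule.smul_le]
      intro r hr y hy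
      refine ⟨r • ⟨y, hy⟩, ?_, rfl⟩
      rw [SetLike.mem_coe, LinearMap.mem_ker, map_smul, hs r hr]
    obtain ⟨y, hy, hyx⟩ := h₃ h₂
    rw [← Subtype.ext hyx]
    exact hy
  let P : Submodule B K := Submodule.comap (Submodule.subtype K) (I ^ (s + k))
  let i : (K ⧸ P) →ₗ[B] (B ⧸ I ^ (s + k)) := P.mapQ (I ^ (s + k)) (Submodule.subtype K) le_rfl
  have hi : Function.Injective i := by
    rw [← LinearMap.ker_eq_bot]
    exact Submodule.ker_liftQ_eq_bot _ _ _ (fun x hx => by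
      rw [LinearMap.mem_ker, LinearMap.comp_apply, Submodule.mkQ_apply,
        Submodule.Quotient.mk_eq_zero] at hx
      exact hx)
  obtain ⟨h, hh⟩ := Module.Injective.out (Q := E) i hi
    ((powTorsion I E).subtype ∘ₗ P.liftQ g (fun x hx => hker x hx))
  refine ⟨LinearMap.codRestrict _ (h ∘ₗ (I ^ (s + k)).mkQ) fun r => ⟨s + k, fun a ha => ?_⟩,
    fun x hx => Subtype.ext (hh (Submodule.Quotient.mk ⟨x, hx⟩))⟩
  rw [← map_smul, LinearMap.comp_apply, Submodule.mkQ_apply, smul_eq_mul,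
    (Submodule.Quotient.mk_eq_zero _).2 (Ideal.mul_mem_right r _ ha), map_zero]

theorem smul_injective_quotient_powTorsion (b : B) :
    Function.Injective fun e : E ⧸ powTorsion (Ideal.span {b}) E => b • e := by
  refine (injective_iff_map_eq_zero (DistribSMul.toAddMonoidHom _ b)).2 fun e he => ?_
  obtain ⟨e, rfl⟩ := Submodule.Quotient.mk_surjective _ e
  rw [DistribSMul.toAddMonoidHom_apply, ← Submodule.Quotient.mk_smul,
    Submodule.Quotient.mk_eq_zero, mem_powTorsion_singleton] at he
  obtain ⟨t, ht⟩ := he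
  rw [Submodule.Quotient.mk_eq_zero, mem_powTorsion_singleton]
  exact ⟨t + 1, by rw [pow_succ, mul_smul, ht]⟩

/-- The annihilators of the powers of `b` stabilize at some `n`, so `b^(n+1) ↦ b^n e` is well
defined on the ideal `(b^(n+1))` and extends to `h : B → E`. Then `b h(1) - e` is killed by `b^n`.
-/
theorem smul_surjective_quotient_powTorsion [IsNoetherianRing B] [Module.Injective B E] (b : B) :
    Function.Surjective fun e : E ⧸ powTorsion (Ideal.span {b}) E => b • e := by
  intro e
  obtain ⟨e, rfl⟩ := Submodule.Quotient.mk_surjective _ e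
  obtain ⟨n, hn⟩ := monotone_stabilizes_iff_noetherian.2 (inferInstance : IsNoetherian B B)
    ⟨fun n => LinearMap.ker (LinearMap.lsmul B B (b ^ n)), fun m n hmn x hx => by
      obtain ⟨c, rfl⟩ := Nat.exists_eq_add_of_le' hmn
      rw [LinearMap.mem_ker, LinearMap.lsmul_apply] at hx ⊢
      rw [pow_add, mul_smul, hx, smul_zero]⟩
  have hk : LinearMap.ker (LinearMap.toSpanSingleton B B (b ^ (n + 1))) ≤
      LinearMap.ker (LinearMap.toSpanSingleton B E (b ^ n • e)) := by
    intro r hr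
    have h₁ : r ∈ LinearMap.ker (LinearMap.lsmul B B (b ^ (n + 1))) := by
      rw [LinearMap.mem_ker, LinearMap.toSpanSingleton_apply] at hr
      rw [LinearMap.mem_ker, LinearMap.lsmul_apply, smul_eq_mul, mul_comm]
      exact hr
    have h₂ : r ∈ LinearMap.ker (LinearMap.lsmul B B (b ^ n)) := by
      have := hn (n + 1) (Nat.le_succ n)
      exact this.symm.le h₁
    rw [LinearMap.mem_ker, LinearMap.lsmul_apply, smul_eq_mul] at h₂
    rw [LinearMap.mem_ker, LinearMap.toSpanSingleton_apply, smul_smul, mul_comm, h₂, zero_smul]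
  obtain ⟨h, hh⟩ := Module.Injective.out (Q := E)
    ((LinearMap.ker (LinearMap.toSpanSingleton B B (b ^ (n + 1)))).liftQ _ le_rfl)
    (LinearMap.ker_eq_bot.1 (Submodule.ker_liftQ_eq_bot _ _ _ le_rfl))
    ((LinearMap.ker (LinearMap.toSpanSingleton B B (b ^ (n + 1)))).liftQ _ hk)
  have h₁ : h (b ^ (n + 1)) = b ^ n • e := by
    have := hh (Submodule.Quotient.mk 1)
    rwa [Submodule.liftQ_apply, Submodule.liftQ_apply, LinearMap.toSpanSingleton_apply,
      LinearMap.toSpanSingleton_apply, one_smul, one_smul] at this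
  refine ⟨Submodule.Quotient.mk (h 1), ?_⟩
  dsimp only
  rw [← Submodule.Quotient.mk_smul, Submodule.Quotient.eq, mem_powTorsion_singleton]
  refine ⟨n, ?_⟩
  rw [smul_sub, smul_smul, ← pow_succ, ← map_smul, smul_eq_mul, mul_one, h₁, sub_self]

end PowTorsion

/-! ### Modules acyclic for local cohomology. -/

namespace LocalCohomology

open Limits Opposite

section Acyclic

variable {A : Type u} [CommRing A] (I : Ideal A)

theorem map_pow_smul_id (M : ModuleCat.{u} A) (a : A) (t n : ℕ) (ξ : (localCohomology I n).obj M) :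
    (localCohomology I n).map ((a ^ t) • 𝟙 M) ξ =
      ((localCohomology I n).map (a • 𝟙 M))^[t] ξ := by
  induction t generalizing ξ with
  | zero => rw [pow_zero, one_smul, CategoryTheory.Functor.map_id]; rfl
  | succ t ih =>
    rw [Function.iterate_succ_apply, ← ih]
    have h : (a ^ (t + 1)) • 𝟙 M = (a • 𝟙 M) ≫ ((a ^ t) • 𝟙 M) := by
      rw [Linear.smul_comp, Category.id_comp, smul_smul, pow_succ']
    rw [h, Functor.map_comp]
    rfl

/-- Local cohomology vanishes if some element of the ideal acts bijectively. -/
theorem isZero_of_bijective_smul (M : ModuleCat.{u} A) (a : A) (ha : a ∈ I)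
    (h : Function.Bijective fun m : M => a • m) (n : ℕ) : IsZero ((localCohomology I n).obj M) := by
  have h₁ : IsIso (a • 𝟙 M) := by
    rw [ConcreteCategory.isIso_iff_bijective]
    exact h
  have h₂ : Function.Injective ((localCohomology I n).map (a • 𝟙 M)) :=
    (ConcreteCategory.bijective_of_isIso _).1
  rw [ModuleCat.isZero_iff_subsingleton, subsingleton_iff_forall_eq 0]
  intro ξ
  -- The element `a` acts injectively on local cohomology, yet some power of it kills `ξ`.
  obtain ⟨t, ht⟩ := exists_pow_map_smul_eq_zero I n ξ
  have := ht (a ^ t) (Ideal.pow_mem_pow ha t)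
  rw [map_pow_smul_id] at this
  refine h₂.iterate t (this.trans ?_)
  rw [← map_pow_smul_id]
  exact (map_zero _).symm

/-- The short complex of a submodule and its quotient. -/
noncomputable abbrev submoduleSeq {E : Type u} [AddCommGroup E] [Module A E] (N : Submodule A E) :
    ShortComplex (ModuleCat.{u} A) :=
  ShortComplex.mk (X₁ := ModuleCat.of A N) (X₂ := ModuleCat.of A E) (X₃ := ModuleCat.of A (E ⧸ N))
    (ModuleCat.ofHom N.subtype) (ModuleCat.ofHom N.mkQ)
    (ModuleCat.hom_ext (LinearMap.ext fun x => (Submodule.Quotient.mk_eq_zero _).2 x.2))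

theorem submoduleSeq_shortExact {E : Type u} [AddCommGroup E] [Module A E] (N : Submodule A E) :
    (submoduleSeq N).ShortExact where
  exact := (ShortComplex.moduleCat_exact_iff _).2 fun x hx =>
    ⟨⟨x, (Submodule.Quotient.mk_eq_zero _).1 hx⟩, rfl⟩
  mono_f := (ModuleCat.mono_iff_injective _).2 N.subtype_injective
  epi_g := (ModuleCat.epi_iff_surjective _).2 N.mkQ_surjective

/-- The short complex of an injective linear map and its cokernel. -/
noncomputable abbrev quotientSeq {M N : Type u} [AddCommGroup M] [Module A M] [AddCommGroup N]
    [Module A N] (j : M →ₗ[A] N) : ShortComplex (ModuleCat.{u} A) :=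
  ShortComplex.mk (X₁ := ModuleCat.of A M) (X₂ := ModuleCat.of A N)
    (X₃ := ModuleCat.of A (N ⧸ LinearMap.range j))
    (ModuleCat.ofHom j) (ModuleCat.ofHom (LinearMap.range j).mkQ)
    (ModuleCat.hom_ext (LinearMap.ext fun x => (Submodule.Quotient.mk_eq_zero _).2 ⟨x, rfl⟩))

theorem quotientSeq_shortExact {M N : Type u} [AddCommGroup M] [Module A M] [AddCommGroup N]
    [Module A N] (j : M →ₗ[A] N) (hj : Function.Injective j) : (quotientSeq j).ShortExact where
  exact := (ShortComplex.moduleCat_exact_iff _).2 fun _ hx =>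
    (Submodule.Quotient.mk_eq_zero (LinearMap.range j)).1 hx
  mono_f := (ModuleCat.mono_iff_injective _).2 hj
  epi_g := (ModuleCat.epi_iff_surjective _).2 (LinearMap.range j).mkQ_surjective

theorem exists_injective_torsion [IsNoetherianRing A] (M : Type u) [AddCommGroup M] [Module A M]
    (hM : ∀ m : M, m ∈ powTorsion I M) :
    ∃ (G : ModuleCat.{u} A) (j : M →ₗ[A] G), Injective G ∧ (∀ g : G, g ∈ powTorsion I G) ∧
      Function.Injective j := by
  let E := Injective.under (ModuleCat.of A M)
  let i : M →ₗ[A] E := (Injective.ι (ModuleCat.of A M)).hom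
  have : Injective (ModuleCat.of A E) := Injective.injective_under (ModuleCat.of A M)
  have : Module.Injective A E := Module.injective_module_of_injective_object A E
  have := injective_powTorsion (E := E) I
  refine ⟨ModuleCat.of A (powTorsion I E), i.codRestrict _ fun m => ?_,
    Module.injective_object_of_injective_module A _, fun ⟨e, t, ht⟩ =>
      ⟨t, fun r hr => Subtype.ext (ht r hr)⟩, ?_⟩
  · obtain ⟨t, ht⟩ := hM m
    exact ⟨t, fun r hr => by rw [← map_smul, ht r hr, map_zero]⟩
  · intro a b h
    exact (ModuleCat.mono_iff_injective (Injective.ι (ModuleCat.of A M))).1 inferInstance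
      (congrArg Subtype.val h)

theorem surjective_map_zero_of_torsion {M N : ModuleCat.{u} A} (g : M ⟶ N)
    (hg : Function.Surjective g) (hM : ∀ m : M, m ∈ powTorsion I M) :
    Function.Surjective ((localCohomology I 0).map g) := by
  intro ξ
  obtain ⟨m, hm⟩ := hg ((toSelf I).app N ξ)
  obtain ⟨η, hη⟩ := (mem_range_toSelf I M m).2 (hM m)
  refine ⟨η, toSelf_injective I N ?_⟩
  exact (ConcreteCategory.congr_hom ((toSelf I).naturality g) η).trans
    ((congrArg g hη).trans hm)

/-- Modules which are `I`-power torsion have no higher local cohomology. -/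
theorem isZero_of_torsion [IsNoetherianRing A] (n : ℕ) (M : Type u) [AddCommGroup M] [Module A M]
    (hM : ∀ m : M, m ∈ powTorsion I M) :
    IsZero ((localCohomology I (n + 1)).obj (ModuleCat.of A M)) := by
  induction n generalizing M with
  | zero =>
    -- On torsion modules `H^0` is the identity, so `H^0(G) → H^0(G/M)` is onto. As `H^1(G) = 0`,
    -- this forces `H^1(M) = 0`; higher degrees follow by dimension shifting, since `G/M` is again
    -- torsion.
    obtain ⟨G, j, hG, hG', hj⟩ := exists_injective_torsion I M hM
    have hS := quotientSeq_shortExact j hj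
    have : Epi ((localCohomology I 0).map (quotientSeq j).g) := by
      rw [ModuleCat.epi_iff_surjective]
      exact surjective_map_zero_of_torsion I _ (LinearMap.range j).mkQ_surjective hG'
    refine ((cohomologicalFunctor I).exact₁ hS 0).isZero_X₂ ?_
      ((effaceable I 0 G hG).eq_of_tgt _ _)
    exact (cancel_epi ((localCohomology I 0).map (quotientSeq j).g)).1
      (((cohomologicalFunctor I).comp_δ hS 0).trans comp_zero.symm)
  | succ n ih =>
    obtain ⟨G, j, hG, hG', hj⟩ := exists_injective_torsion I M hM
    have hS := quotientSeq_shortExact j hj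
    refine ((cohomologicalFunctor I).exact₁ hS (n + 1)).isZero_X₂ ?_
      ((effaceable I (n + 1) G hG).eq_of_tgt _ _)
    refine (ih (G ⧸ LinearMap.range j) fun g => ?_).eq_of_src _ _
    obtain ⟨g, rfl⟩ := Submodule.Quotient.mk_surjective _ g
    obtain ⟨t, ht⟩ := hG' g
    exact ⟨t, fun r hr => by rw [← Submodule.Quotient.mk_smul, ht r hr]; rfl⟩

end Acyclic

/-! ### Independence of the base ring. -/

section BaseChange

variable {A B : Type u} [CommRing A] [CommRing B] (f : A →+* B) (I : Ideal A)

/-- The hypothesis `hE` is shaped for induction on `s`. For `a ∈ s`, the `f a`-torsion of `E` is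
again injective and satisfies `hE` for the remaining elements, while `f a` acts bijectively on the
quotient, which is therefore acyclic. For empty `s`, `hE` says that `E` is `I`-power torsion. -/
theorem isZero_restrictScalars_of_injective [IsNoetherianRing A] [IsNoetherianRing B]
    (s : Finset A) (hs : ∀ a ∈ s, a ∈ I) (n : ℕ)
    (E : Type u) [AddCommGroup E] [Module B E] [Module.Injective B E]
    (hE : ∀ e : E, (∀ a ∈ s, ∃ t, f a ^ t • e = 0) → ∃ t, ∀ r ∈ I ^ t, f r • e = 0) :
    IsZero ((localCohomology I (n + 1)).obj
      ((ModuleCat.restrictScalars f).obj (ModuleCat.of B E))) := by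
  classical
  induction s using Finset.induction_on generalizing E with
  | empty =>
    exact isZero_of_torsion I n ((ModuleCat.restrictScalars f).obj (ModuleCat.of B E))
      fun e => hE e (by simp)
  | insert a s _ ih =>
    have hinj := injective_powTorsion (E := E) (Ideal.span {f a})
    have h₁ := ih (fun b hb => hs b (Finset.mem_insert_of_mem hb))
      (powTorsion (Ideal.span {f a}) E) (by
        intro e he
        obtain ⟨t, ht⟩ := hE e fun b hb => by
          rcases Finset.mem_insert.1 hb with rfl | hb
          · exact mem_powTorsion_singleton.1 e.2
          · obtain ⟨t, ht⟩ := he b hb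
            exact ⟨t, congrArg Subtype.val ht⟩
        exact ⟨t, fun r hr => Subtype.ext (ht r hr)⟩)
    have h₂ : IsZero ((localCohomology I (n + 1)).obj ((ModuleCat.restrictScalars f).obj
        (ModuleCat.of B (E ⧸ powTorsion (Ideal.span {f a}) E)))) :=
      isZero_of_bijective_smul I _ a (hs a (Finset.mem_insert_self a s))
        ⟨smul_injective_quotient_powTorsion (f a), smul_surjective_quotient_powTorsion (f a)⟩ _
    exact (((cohomologicalFunctor I).precomp (ModuleCat.restrictScalars f)).exact₂
      (submoduleSeq_shortExact (powTorsion (Ideal.span {f a}) E)) (n + 1)).isZero_X₂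
        (h₁.eq_of_src _ _) (h₂.eq_of_tgt _ _)

theorem effaceable_restrictScalars [IsNoetherianRing A] [IsNoetherianRing B] :
    ((cohomologicalFunctor I).precomp (ModuleCat.restrictScalars f)).Effaceable := by
  intro n E hE
  have : Injective (ModuleCat.of B E) := hE
  have : Module.Injective B E := Module.injective_module_of_injective_object B E
  obtain ⟨s, hs⟩ := IsNoetherian.noetherian I
  refine isZero_restrictScalars_of_injective f I s (fun a ha => hs ▸ Submodule.subset_span ha) n E
    fun e he => ?_
  -- With `s` a generating set of `I`, an element killed by a power of each generator has
  -- annihilator whose radical contains `I`; finite generation then gives a uniform power.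
  have hle : I ≤ (Ideal.comap f (LinearMap.ker (LinearMap.toSpanSingleton B E e))).radical := by
    rw [← hs, Submodule.span_le]
    intro a ha
    obtain ⟨t, ht⟩ := he a ha
    refine ⟨t, ?_⟩
    rw [Ideal.mem_comap, LinearMap.mem_ker, LinearMap.toSpanSingleton_apply, map_pow, ht]
  obtain ⟨t, ht⟩ := Ideal.exists_pow_le_of_le_radical_of_fg hle (IsNoetherian.noetherian I)
  exact ⟨t, fun r hr => ht hr⟩

/-- Local cohomology along a ring homomorphism, as a functor to abelian groups. -/
noncomputable abbrev abFunctor : CohomologicalFunctor (ModuleCat.{u} B) AddCommGrpCat.{u} :=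
  ((cohomologicalFunctor I).precomp (ModuleCat.restrictScalars f)).postcomp
    (forget₂ (ModuleCat.{u} A) AddCommGrpCat.{u})

theorem abFunctor_effaceable [IsNoetherianRing A] [IsNoetherianRing B] :
    (abFunctor f I).Effaceable := fun n E hE =>
  (forget₂ (ModuleCat.{u} A) AddCommGrpCat.{u}).map_isZero (effaceable_restrictScalars f I n E hE)

variable {f I}

/-- The degree `0` comparison of local cohomology along two ring homomorphisms to `B`. -/
theorem exists_zero_map {A' : Type u} [CommRing A'] {f' : A' →+* B} {I' : Ideal A'}
    (h : ∀ (M : ModuleCat.{u} B) (m : M), (∃ t, ∀ r ∈ I ^ t, f r • m = 0) →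
      ∃ t, ∀ r ∈ I' ^ t, f' r • m = 0) (M : ModuleCat.{u} B) :
    ∃ g : (localCohomology I 0).obj ((ModuleCat.restrictScalars f).obj M) →+
      (localCohomology I' 0).obj ((ModuleCat.restrictScalars f').obj M),
      ∀ ξ, ((toSelf I').app ((ModuleCat.restrictScalars f').obj M) (g ξ) : M) =
        (toSelf I).app ((ModuleCat.restrictScalars f).obj M) ξ := by
  choose g hg using fun ξ : (localCohomology I 0).obj ((ModuleCat.restrictScalars f).obj M) =>
    (mem_range_toSelf I' ((ModuleCat.restrictScalars f').obj M)
      ((toSelf I).app ((ModuleCat.restrictScalars f).obj M) ξ : M)).2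
      (h M _ ((mem_range_toSelf I _ _).1 ⟨ξ, rfl⟩))
  refine ⟨AddMonoidHom.mk' g fun a b => ?_, hg⟩
  apply toSelf_injective I'
  rw [map_add ((toSelf I').app ((ModuleCat.restrictScalars f').obj M)).hom, hg, hg, hg,
    map_add ((toSelf I).app ((ModuleCat.restrictScalars f).obj M)).hom]
  rfl

variable {A' : Type u} [CommRing A'] {f' : A' →+* B} {I' : Ideal A'}

theorem exists_pow_smul_eq_zero_of_radical_le [IsNoetherianRing B]
    (h : (I'.map f').radical ≤ (I.map f).radical) (M : ModuleCat.{u} B) (m : M)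
    (hm : ∃ t, ∀ r ∈ I ^ t, f r • m = 0) : ∃ t, ∀ r ∈ I' ^ t, f' r • m = 0 := by
  obtain ⟨t, ht⟩ := hm
  let K : Ideal B := LinearMap.ker (LinearMap.toSpanSingleton B M m)
  have h₁ : (I.map f) ^ t ≤ K := by
    rw [← Ideal.map_pow, Ideal.map_le_iff_le_comap]
    exact fun r hr => ht r hr
  have h₂ : I'.map f' ≤ K.radical := by
    rintro r hr
    obtain ⟨n, hn⟩ := h (Ideal.le_radical hr)
    exact ⟨n * t, h₁ (pow_mul r n t ▸ Ideal.pow_mem_pow hn t)⟩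
  obtain ⟨s, hs⟩ := Ideal.exists_pow_le_of_le_radical_of_fg h₂ (IsNoetherian.noetherian _)
  exact ⟨s, fun r hr => hs (Ideal.map_pow f' I' s ▸ Ideal.mem_map_of_mem f' hr)⟩

/-- Degree `0` local cohomology only depends on the ideal generated, up to radical. -/
theorem nonempty_zero_iso [IsNoetherianRing B] (h : (I.map f).radical = (I'.map f').radical) :
    Nonempty ((abFunctor f I).T 0 ≅ (abFunctor f' I').T 0) := by
  choose g hg using exists_zero_map (exists_pow_smul_eq_zero_of_radical_le h.ge)
  choose g' hg' using exists_zero_map (exists_pow_smul_eq_zero_of_radical_le h.le)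
  refine ⟨NatIso.ofComponents (fun M =>
    { hom := AddCommGrpCat.ofHom (g M)
      inv := AddCommGrpCat.ofHom (g' M)
      hom_inv_id := ?_
      inv_hom_id := ?_ }) ?_⟩
  · ext ξ
    exact toSelf_injective I _ ((hg' M _).trans (hg M ξ))
  · ext ξ
    exact toSelf_injective I' _ ((hg M _).trans (hg' M ξ))
  · intro M N φ
    ext ξ
    apply toSelf_injective I'
    refine (hg N _).trans ?_
    have h₁ := ConcreteCategory.congr_hom
      ((toSelf I).naturality ((ModuleCat.restrictScalars f).map φ)) ξ
    have h₂ := ConcreteCategory.congr_hom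
      ((toSelf I').naturality ((ModuleCat.restrictScalars f').map φ)) (g M ξ)
    exact h₁.trans ((congrArg φ (hg M ξ)).symm.trans h₂.symm)

/-- Independence of the base: for Noetherian rings, local cohomology of a `B`-module along a ring
homomorphism to `B` depends, as an abelian group, only on the ideal generated, up to radical. -/
theorem nonempty_iso [IsNoetherianRing A] [IsNoetherianRing A'] [IsNoetherianRing B]
    (h : (I.map f).radical = (I'.map f').radical) (n : ℕ) :
    Nonempty ((abFunctor f I).T n ≅ (abFunctor f' I').T n) :=
  (abFunctor_effaceable f I).nonempty_iso (abFunctor_effaceable f' I')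
    (nonempty_zero_iso h).some n

theorem injective_map_restrictScalars [IsNoetherianRing A] [IsNoetherianRing A']
    [IsNoetherianRing B] (h : (I.map f).radical = (I'.map f').radical) (n : ℕ)
    {M N : ModuleCat.{u} B} (φ : M ⟶ N)
    (hφ : Function.Injective ((localCohomology I n).map ((ModuleCat.restrictScalars f).map φ))) :
    Function.Injective ((localCohomology I' n).map ((ModuleCat.restrictScalars f').map φ)) := by
  obtain ⟨e⟩ := nonempty_iso h n
  have : Mono (((abFunctor f I).T n).map φ) := (AddCommGrpCat.mono_iff_injective _).2 hφ
  have h₁ : ((abFunctor f' I').T n).map φ =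
      e.inv.app M ≫ ((abFunctor f I).T n).map φ ≫ e.hom.app N := by
    rw [e.hom.naturality, ← Category.assoc, Iso.inv_hom_id_app, Category.id_comp]
  have : Mono (((abFunctor f' I').T n).map φ) := h₁ ▸ inferInstance
  exact (AddCommGrpCat.mono_iff_injective (((abFunctor f' I').T n).map φ)).1 this

/-- The case where one base is `B` itself. It is used for `R → R/x` and for the Frobenius `R → R`.
-/
theorem injective_map_restrictScalars_of_injective [IsNoetherianRing A] [IsNoetherianRing B]
    {J : Ideal B} (h : J.radical = (I.map f).radical) (n : ℕ) {M N : ModuleCat.{u} B} (φ : M ⟶ N)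
    (hφ : Function.Injective ((localCohomology J n).map φ)) :
    Function.Injective ((localCohomology I n).map ((ModuleCat.restrictScalars f).map φ)) := by
  refine injective_map_restrictScalars (f := RingHom.id B) (I := J) (by rwa [Ideal.map_id]) n φ ?_
  let e := ModuleCat.restrictScalarsId.{u} B
  have : Mono ((localCohomology J n).map φ) := (ModuleCat.mono_iff_injective _).2 hφ
  rw [← ModuleCat.mono_iff_injective]
  have h₁ : (ModuleCat.restrictScalars (RingHom.id B)).map φ = e.hom.app M ≫ φ ≫ e.inv.app N := by
    have := e.hom.naturality φ
    rw [← reassoc_of% this, Iso.hom_inv_id_app]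
    exact (Category.comp_id _).symm
  rw [h₁, Functor.map_comp, Functor.map_comp]
  infer_instance

end BaseChange

end LocalCohomology

/-! ### The short exact sequences attached to `x` and the Frobenius. -/

namespace FInj

open Limits LocalCohomology

variable {R : Type u} [CommRing R] (x : R)

/-- The cyclic module `R / x ^ ℓ R`. -/
abbrev quotSpanPow (ℓ : ℕ) : ModuleCat.{u} R := ModuleCat.of R (R ⧸ Ideal.span {x ^ ℓ})

/-- Multiplication by `x` as a map `R / x ^ ℓ R → R / x ^ (ℓ + 1) R`. -/
noncomputable def mulHom (ℓ : ℕ) : quotSpanPow x ℓ ⟶ quotSpanPow x (ℓ + 1) :=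
  ModuleCat.ofHom (Submodule.mapQ _ _ (LinearMap.lsmul R R x) (by
    rw [Ideal.span, Submodule.span_le, Set.singleton_subset_iff]
    exact Ideal.mem_span_singleton.2 (by
      rw [LinearMap.lsmul_apply, smul_eq_mul, ← pow_succ'])))

/-- The short complex `R / x ^ ℓ R → R / x ^ (ℓ + 1) R → R / x R`. -/
noncomputable abbrev powSeq (ℓ : ℕ) : ShortComplex (ModuleCat.{u} R) :=
  ShortComplex.mk (mulHom x ℓ) (quotientPowHom x ℓ.succ_pos) (by
    refine ModuleCat.hom_ext (LinearMap.ext fun r => ?_)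
    obtain ⟨r, rfl⟩ := Submodule.Quotient.mk_surjective _ r
    refine (Submodule.Quotient.mk_eq_zero (Ideal.span {x})).2 ?_
    exact Ideal.mul_mem_right _ _ (Ideal.mem_span_singleton_self x))

theorem powSeq_shortExact (hx : x ∈ nonZeroDivisors R) (ℓ : ℕ) : (powSeq x ℓ).ShortExact where
  exact := by
    rw [ShortComplex.moduleCat_exact_iff]
    intro r hr
    obtain ⟨r, rfl⟩ := Submodule.Quotient.mk_surjective _ r
    obtain ⟨s, rfl⟩ := Ideal.mem_span_singleton.1
      ((Submodule.Quotient.mk_eq_zero (Ideal.span {x})).1 hr)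
    refine ⟨Submodule.Quotient.mk s, congrArg (Submodule.Quotient.mk (p := Ideal.span {x ^ (ℓ + 1)}))
      rfl⟩
  mono_f := by
    rw [ModuleCat.mono_iff_injective, injective_iff_map_eq_zero]
    intro r hr
    obtain ⟨r, rfl⟩ := Submodule.Quotient.mk_surjective _ r
    obtain ⟨s, hs⟩ := Ideal.mem_span_singleton.1
      ((Submodule.Quotient.mk_eq_zero (Ideal.span {x ^ (ℓ + 1)})).1 hr)
    refine (Submodule.Quotient.mk_eq_zero _).2 (Ideal.mem_span_singleton.2 ⟨s, ?_⟩)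
    refine (mul_cancel_left_mem_nonZeroDivisors hx).1 ?_
    change x * r = _ at hs
    rw [hs]
    ring
  epi_g := (ModuleCat.epi_iff_surjective _).2 fun r => by
    obtain ⟨r, rfl⟩ := Submodule.Quotient.mk_surjective _ r
    exact ⟨Submodule.Quotient.mk r, rfl⟩

/-- The short complex `R → R → R / x R`, the first map being multiplication by `x`. -/
noncomputable abbrev mulSeq : ShortComplex (ModuleCat.{u} R) :=
  ShortComplex.mk (X₃ := ModuleCat.of R (R ⧸ Ideal.span {x}))
    (x • 𝟙 (ModuleCat.of R R)) (ModuleCat.ofHom (Ideal.span {x}).mkQ)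
    (ModuleCat.hom_ext (LinearMap.ext fun r => (Submodule.Quotient.mk_eq_zero _).2
      (Ideal.mul_mem_right r _ (Ideal.mem_span_singleton_self x))))

theorem mulSeq_shortExact (hx : x ∈ nonZeroDivisors R) : (mulSeq x).ShortExact where
  exact := (ShortComplex.moduleCat_exact_iff _).2 fun r hr => by
    obtain ⟨s, rfl⟩ := Ideal.mem_span_singleton.1
      ((Submodule.Quotient.mk_eq_zero (Ideal.span {x})).1 hr)
    exact ⟨s, rfl⟩
  mono_f := (ModuleCat.mono_iff_injective _).2 fun a b h =>
    (mul_cancel_left_mem_nonZeroDivisors hx).1 h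
  epi_g := (ModuleCat.epi_iff_surjective _).2 (Submodule.mkQ_surjective _)

/-- Multiplication by `x ^ t` as a map `R / x R → R / x ^ (t + 1) R`. -/
noncomputable abbrev socleHom (t : ℕ) :
    ModuleCat.of R (R ⧸ Ideal.span {x}) ⟶ quotSpanPow x (t + 1) :=
  ModuleCat.ofHom (Submodule.mapQ _ _ (LinearMap.lsmul R R (x ^ t)) (by
    rw [Ideal.span, Submodule.span_le, Set.singleton_subset_iff]
    exact Ideal.mem_span_singleton.2 (by
      rw [LinearMap.lsmul_apply, smul_eq_mul, ← pow_succ])))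

/-- For a surjective element `x`, multiplication by `x ^ t` induces injections
`H^n(R / x R) → H^n(R / x ^ (t + 1) R)`. -/
theorem injective_map_socleHom (J : Ideal R) (hx : x ∈ nonZeroDivisors R)
    (hsurj : ∀ (ℓ : ℕ) (hℓ : 0 < ℓ) (i : ℕ), Function.Surjective
      ((localCohomology J i).map (quotientPowHom x hℓ))) (t n : ℕ) :
    Function.Injective ((localCohomology J n).map (socleHom x t)) := by
  rw [← ModuleCat.mono_iff_injective]
  induction t with
  | zero =>
    -- The modules `R/x` and `R/x^(0+1)` are not syntactically equal; a left inverse is enough for a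
    -- monomorphism.
    have h : socleHom x 0 ≫ quotientPowHom x Nat.one_pos = 𝟙 _ := by
      refine ModuleCat.hom_ext (LinearMap.ext fun r => ?_)
      obtain ⟨r, rfl⟩ := Submodule.Quotient.mk_surjective _ r
      refine congrArg (Submodule.Quotient.mk (p := Ideal.span {x})) ?_
      change x ^ 0 * r = r
      rw [pow_zero, one_mul]
    have : Mono ((localCohomology J n).map (socleHom x 0) ≫
        (localCohomology J n).map (quotientPowHom x Nat.one_pos)) := by
      rw [← Functor.map_comp, h, CategoryTheory.Functor.map_id]
      infer_instance
    exact mono_of_mono _ ((localCohomology J n).map (quotientPowHom x Nat.one_pos))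
  | succ t ih =>
    have h : socleHom x (t + 1) = socleHom x t ≫ mulHom x (t + 1) := by
      refine ModuleCat.hom_ext (LinearMap.ext fun r => ?_)
      obtain ⟨r, rfl⟩ := Submodule.Quotient.mk_surjective _ r
      refine congrArg (Submodule.Quotient.mk (p := Ideal.span {x ^ (t + 1 + 1)})) ?_
      change x ^ (t + 1) * r = x * (x ^ t * r)
      ring
    have hS := powSeq_shortExact x hx (t + 1)
    have : Mono ((localCohomology J n).map (powSeq x (t + 1)).f) := by
      cases n with
      | zero => exact (cohomologicalFunctor J).mono_zero hS
      | succ n =>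
        -- The kernel is the image of the connecting map from `H^n(R/x)`, which is zero because
        -- `H^n(R/x^(t+2)) → H^n(R/x)` is surjective.
        refine ((cohomologicalFunctor J).exact₁ hS n).mono_g ?_
        have : Epi ((localCohomology J n).map (powSeq x (t + 1)).g) :=
          (ModuleCat.epi_iff_surjective _).2 (hsurj (t + 1 + 1) (t + 1).succ_pos n)
        exact (cancel_epi ((localCohomology J n).map (powSeq x (t + 1)).g)).1
          (((cohomologicalFunctor J).comp_δ hS n).trans comp_zero.symm)
    rw [h, Functor.map_comp]
    exact mono_comp _ _

/-- The connecting morphism of `R → R → R / x R` is injective if the maps `socleHom x t` are and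
multiplication by `x` is locally nilpotent. -/
theorem injective_δ_mulSeq (T : CohomologicalFunctor (ModuleCat.{u} R) (ModuleCat.{u} R))
    (hx : x ∈ nonZeroDivisors R) (n : ℕ)
    (hT : ∀ ξ : (T.T n).obj (ModuleCat.of R R), ∃ t : ℕ,
      (T.T n).map (x ^ t • 𝟙 (ModuleCat.of R R)) ξ = 0)
    (hinj : ∀ t, Function.Injective ((T.T n).map (socleHom x t))) :
    Function.Injective (T.δ (mulSeq_shortExact x hx) n) := by
  rw [injective_iff_map_eq_zero]
  intro ξ hξ
  obtain ⟨η, rfl⟩ := (ShortComplex.moduleCat_exact_iff _).1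
    (T.exact₃ (mulSeq_shortExact x hx) n) ξ hξ
  obtain ⟨t, ht⟩ := hT η
  -- Multiplying by `x^t` after projecting to `R/x` agrees with multiplying in `R` and then
  -- projecting to `R/x^(t+1)`; the latter kills `η`.
  have h : (mulSeq x).g ≫ socleHom x t = (x ^ t • 𝟙 (ModuleCat.of R R)) ≫
      ModuleCat.ofHom (Ideal.span {x ^ (t + 1)}).mkQ := rfl
  have h₁ := ConcreteCategory.congr_hom (congrArg (T.T n).map h) η
  rw [Functor.map_comp, Functor.map_comp] at h₁
  refine hinj t (h₁.trans ?_)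
  refine (congrArg ((T.T n).map (ModuleCat.ofHom (Ideal.span {x ^ (t + 1)}).mkQ)) ht).trans ?_
  rw [map_zero, map_zero]

section Frobenius

variable (p : ℕ) [Fact p.Prime] [CharP R p]

theorem smul_comp_frobeniusHom (r : R) :
    (r • 𝟙 (ModuleCat.of R R)) ≫ frobeniusHom R p = frobeniusHom R p ≫
      (ModuleCat.restrictScalars (frobenius R p)).map (r ^ p • 𝟙 (ModuleCat.of R R)) :=
  ModuleCat.hom_ext (LinearMap.ext fun s => mul_pow r s p)

/-- The Frobenius of `R / x R`, as a map of `R`-modules. -/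
noncomputable def quotFrobeniusHom : ModuleCat.of R (R ⧸ Ideal.span {x}) ⟶
    frobeniusPushforward p (ModuleCat.of R (R ⧸ Ideal.span {x})) :=
  ModuleCat.ofHom (Y := frobeniusPushforward p (ModuleCat.of R (R ⧸ Ideal.span {x})))
    (Submodule.liftQ (Ideal.span {x})
      (frobeniusHom R p ≫ (ModuleCat.restrictScalars (frobenius R p)).map
        (ModuleCat.ofHom (Ideal.span {x}).mkQ)).hom (by
      rw [Ideal.span, Submodule.span_le, Set.singleton_subset_iff]
      refine (Submodule.Quotient.mk_eq_zero (Ideal.span {x})).2 ?_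
      exact Ideal.pow_mem_of_mem _ (Ideal.mem_span_singleton_self x) p
        (Fact.out : p.Prime).pos))

/-- The Frobenius as a map of short complexes. -/
noncomputable def frobeniusSeq : mulSeq x ⟶
    (mulSeq x).map (ModuleCat.restrictScalars (frobenius R p)) where
  -- The target sequence is still multiplication by `x`, whereas `F(x s) = x^p F(s)`; the missing
  -- factor `x^(p-1)` goes here.
  τ₁ := frobeniusHom R p ≫ (ModuleCat.restrictScalars (frobenius R p)).map
    (x ^ (p - 1) • 𝟙 (ModuleCat.of R R))
  τ₂ := frobeniusHom R p
  τ₃ := quotFrobeniusHom x p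
  comm₁₂ := by
    have h : x ^ p = x * x ^ (p - 1) := by
      rw [← pow_succ', Nat.sub_add_cancel (Fact.out : p.Prime).pos]
    refine ModuleCat.hom_ext (LinearMap.ext fun (s : R) => ?_)
    change x * (x ^ (p - 1) * s ^ p) = (x * s) ^ p
    rw [mul_pow, h, mul_assoc]
  comm₂₃ := rfl

end Frobenius

variable [IsLocalRing R]

theorem radical_map_frobenius (p : ℕ) [Fact p.Prime] [CharP R p] :
    (maximalIdeal R).radical = ((maximalIdeal R).map (frobenius R p)).radical := by
  apply le_antisymm
  · refine Ideal.radical_le_radical_iff.2 fun r hr => ⟨p, ?_⟩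
    exact Ideal.mem_map_of_mem (frobenius R p) hr
  · refine Ideal.radical_mono (Ideal.map_le_iff_le_comap.2 fun r hr => ?_)
    exact Ideal.pow_mem_of_mem _ hr p (Fact.out : p.Prime).pos

theorem exists_pow_map_restrictScalars_frobenius (p : ℕ) [Fact p.Prime] [CharP R p]
    (hx : x ∈ maximalIdeal R) (n : ℕ)
    (ξ : (localCohomology (maximalIdeal R) n).obj
      ((ModuleCat.restrictScalars (frobenius R p)).obj (ModuleCat.of R R))) :
    ∃ t : ℕ, (localCohomology (maximalIdeal R) n).map
      ((ModuleCat.restrictScalars (frobenius R p)).map (x ^ t • 𝟙 (ModuleCat.of R R))) ξ = 0 := by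
  obtain ⟨t, ht⟩ := exists_pow_map_smul_eq_zero (maximalIdeal R) n ξ
  -- The scalar `x^t` acts on `F_* R` as multiplication by `x^(t p)`.
  refine ⟨t * p, ?_⟩
  rw [← ht (x ^ t) (Ideal.pow_mem_pow hx t)]
  have : (ModuleCat.restrictScalars (frobenius R p)).map (x ^ (t * p) • 𝟙 (ModuleCat.of R R)) =
      x ^ t • 𝟙 ((ModuleCat.restrictScalars (frobenius R p)).obj (ModuleCat.of R R)) := by
    refine ModuleCat.hom_ext (LinearMap.ext fun (s : R) => ?_)
    change x ^ (t * p) * s = (x ^ t) ^ p * s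
    rw [pow_mul]
  rw [this]

/-- `F`-injectivity of `R/x` concerns local cohomology over `R/x`; independence of the base along `R
→ R/x` transports it to local cohomology over `R`. -/
theorem injective_map_quotFrobeniusHom [IsNoetherianRing R] (p : ℕ) [Fact p.Prime] [CharP R p]
    (hx : x ∈ maximalIdeal R)
    (hF : haveI := isLocalRing_quotient hx
      haveI := charP_quotient p hx
      IsFInjective (R ⧸ Ideal.span {x}) p) (n : ℕ) :
    Function.Injective ((localCohomology (maximalIdeal R) n).map (quotFrobeniusHom x p)) := by
  have := isLocalRing_quotient hx
  have := charP_quotient p hx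
  let π := Ideal.Quotient.mk (Ideal.span {x})
  have hπ : Function.Surjective π := Ideal.Quotient.mk_surjective
  have hmax : maximalIdeal (R ⧸ Ideal.span {x}) = (maximalIdeal R).map π :=
    (map_maximalIdeal_of_surjective π hπ).symm
  have h := injective_map_restrictScalars_of_injective (f := π) (I := maximalIdeal R)
    (by rw [hmax]) n _ (hF n)
  let e₁ : ModuleCat.of R (R ⧸ Ideal.span {x}) ≅
      (ModuleCat.restrictScalars π).obj (ModuleCat.of _ (R ⧸ Ideal.span {x})) := Iso.refl _
  -- Restricting along `R → R/x` and pushing forward by Frobenius can be done in either order. The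
  -- comparison is the identity on elements, and only a map in this direction is needed to conclude.
  let e₂ : frobeniusPushforward p (ModuleCat.of R (R ⧸ Ideal.span {x})) ⟶
      (ModuleCat.restrictScalars π).obj
        (frobeniusPushforward p (ModuleCat.of _ (R ⧸ Ideal.span {x}))) :=
    ModuleCat.ofHom (X := frobeniusPushforward p (ModuleCat.of R (R ⧸ Ideal.span {x})))
      (Y := (ModuleCat.restrictScalars π).obj
        (frobeniusPushforward p (ModuleCat.of _ (R ⧸ Ideal.span {x}))))
      { toFun := fun r => (r : R ⧸ Ideal.span {x})
        map_add' := fun _ _ => rfl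
        map_smul' := fun r (s : R ⧸ Ideal.span {x}) => by
          obtain ⟨s, rfl⟩ := Ideal.Quotient.mk_surjective s
          change π (r ^ p * s) = (π r) ^ p * π s
          rw [map_mul, map_pow] }
  have he : quotFrobeniusHom x p ≫ e₂ = e₁.hom ≫
      (ModuleCat.restrictScalars π).map (frobeniusHom (R ⧸ Ideal.span {x}) p) := by
    refine ModuleCat.hom_ext (LinearMap.ext fun r => ?_)
    obtain ⟨r, rfl⟩ := Submodule.Quotient.mk_surjective _ r
    rfl
  rw [← ModuleCat.mono_iff_injective] at h ⊢
  have : Mono ((localCohomology (maximalIdeal R) n).map (quotFrobeniusHom x p) ≫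
      (localCohomology (maximalIdeal R) n).map e₂) := by
    rw [← Functor.map_comp, he, Functor.map_comp]
    exact mono_comp' inferInstance h
  exact mono_of_mono _ ((localCohomology (maximalIdeal R) n).map e₂)

end FInj

/-! ### Injectivity of Frobenius on the local cohomology of `R`. -/

theorem theorem3p5 {R : Type u} [CommRing R] [IsLocalRing R] [IsNoetherianRing R]
    (p : ℕ) [Fact p.Prime] [CharP R p] (x : R) (hx : x ∈ maximalIdeal R)
    (hreg : x ∈ nonZeroDivisors R)
    (hsurj : ∀ (ℓ : ℕ) (hℓ : 0 < ℓ) (i : ℕ), Function.Surjective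
      ((localCohomology (maximalIdeal R) i).map (FInj.quotientPowHom x hℓ)))
    (hF : haveI := FInj.isLocalRing_quotient hx
      haveI := FInj.charP_quotient p hx
      FInj.IsFInjective (R ⧸ Ideal.span {x}) p) :
    FInj.IsFInjective R p := by
  intro i
  let H := LocalCohomology.cohomologicalFunctor (maximalIdeal R)
  let F := ModuleCat.restrictScalars (frobenius R p)
  have hS := FInj.mulSeq_shortExact x hreg
  -- The kernel of Frobenius meets the kernel of `x` trivially.
  have socle : ∀ η : (localCohomology (maximalIdeal R) i).obj (ModuleCat.of R R),
      (localCohomology (maximalIdeal R) i).map (x • 𝟙 (ModuleCat.of R R)) η = 0 →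
      (localCohomology (maximalIdeal R) i).map (FInj.frobeniusHom R p) η = 0 → η = 0 := by
    intro η h₁ h₂
    cases i with
    | zero =>
      exact (ModuleCat.mono_iff_injective _).1 (H.mono_zero hS) (h₁.trans (map_zero _).symm)
    | succ i =>
      obtain ⟨ξ, rfl⟩ := (ShortComplex.moduleCat_exact_iff _).1 (H.exact₁ hS i) η h₁
      -- Injectivity is needed for the connecting map of the pushed-forward sequence, hence the
      -- `δ`-functor `H.precomp F`; the injections `socleHom` are carried over by independence of
      -- the base along Frobenius.
      have hδ := FInj.injective_δ_mulSeq x (H.precomp F) hreg i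
        (FInj.exists_pow_map_restrictScalars_frobenius x p hx i) fun t =>
          LocalCohomology.injective_map_restrictScalars_of_injective
            (FInj.radical_map_frobenius p) i _
            (FInj.injective_map_socleHom x (maximalIdeal R) hreg hsurj t i)
      have hnat := ConcreteCategory.congr_hom
        (H.δ_naturality hS (hS.map_of_exact F) (FInj.frobeniusSeq x p) i) ξ
      have hτ₁ : (H.T (i + 1)).map (FInj.frobeniusSeq x p).τ₁ (H.δ hS i ξ) = 0 := by
        refine (ConcreteCategory.congr_hom ((localCohomology (maximalIdeal R) (i + 1)).map_comp
          (FInj.frobeniusHom R p) (F.map (x ^ (p - 1) • 𝟙 (ModuleCat.of R R)))) _).trans ?_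
        exact (congrArg ((localCohomology (maximalIdeal R) (i + 1)).map (F.map _)) h₂).trans
          (map_zero ((localCohomology (maximalIdeal R) (i + 1)).map (F.map _)).hom)
      have hτ₃ : (H.T i).map (FInj.frobeniusSeq x p).τ₃ ξ = 0 :=
        hδ ((hnat.symm.trans hτ₁).trans (map_zero _).symm)
      have hξ : ξ = 0 := FInj.injective_map_quotFrobeniusHom x p hx hF i
        (hτ₃.trans (map_zero ((H.T i).map (FInj.quotFrobeniusHom x p)).hom).symm)
      exact (congrArg (H.δ hS i) hξ).trans (map_zero (H.δ hS i).hom)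
  have main : ∀ (t : ℕ) (η : (localCohomology (maximalIdeal R) i).obj (ModuleCat.of R R)),
      ((localCohomology (maximalIdeal R) i).map (x • 𝟙 (ModuleCat.of R R)))^[t] η = 0 →
      (localCohomology (maximalIdeal R) i).map (FInj.frobeniusHom R p) η = 0 → η = 0 := by
    intro t
    induction t with
    | zero => exact fun η h _ => h
    | succ t ih =>
      intro η h₁ h₂
      -- By induction `x η = 0`, since `x η` is killed by `x^t` and `F(x η) = x^p F(η) = 0`.
      refine socle η (ih _ h₁ ?_) h₂
      have h := ConcreteCategory.congr_hom (congrArg (localCohomology (maximalIdeal R) i).map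
        (FInj.smul_comp_frobeniusHom p x)) η
      rw [Functor.map_comp, Functor.map_comp] at h
      refine h.trans ((congrArg ((localCohomology (maximalIdeal R) i).map _) h₂).trans
        (map_zero _))
  rw [injective_iff_map_eq_zero]
  intro η hη
  obtain ⟨t, ht⟩ := LocalCohomology.exists_pow_map_smul_eq_zero (maximalIdeal R) i η
  refine main t η ?_ hη
  rw [← LocalCohomology.map_pow_smul_id]
  exact ht _ (Ideal.pow_mem_pow hx t)
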